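/- Let $\Delta=\{(b,a)\in\mathbb{R}^2 : b\in(1,2),\ a\in[0,2-b]\}$. For $(\beta,\alpha)\in\Delta$ put $p=(1-\alpha)/\beta$, let $T^{+}_{\beta,\alpha}(x)=\beta x+\alpha \bmod 1$, and let $T^{-}_{\beta,\alpha}(x)=\beta x+\alpha$ if $x\le p$ and $T^{-}_{\beta,\alpha}(x)=\beta x+\alpha-1$ otherwise. For $x\in[0,1)$ let $\tau^{+}_{\beta,\alpha}(x)\in\{0,1\}^{\mathbb{N}}$ be the word whose $n$-th letter is $0$ if $(T^{+}_{\beta,\alpha})^{n-1}(x)<p$ and $1$ otherwise, and for $x\in(0,1]$ let $\tau^{-}_{\beta,\alpha}(x)$ be the word whose $n$-th letter is $0$ if $(T^{-}_{\beta,\alpha})^{n-1}(x)\le p$ and $1$ otherwise (equivalently, $\tau^{-}_{\beta,\alpha}(x)=\lim_{y\nearrow x}\tau^{+}_{\beta,\alpha}(y)$). The intermediate $\beta$-shift is $$\Omega_{\beta,\alpha}=\tau^{+}_{\beta,\alpha}([0,1))\cup\tau^{-}_{\beta,\alpha}((0,1])\subseteq\{0,1\}^{\mathbb{N}}.$$ Equip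 $\{0,1\}^{\mathbb{N}}$ with the metric $\mathscr{D}(\omega,\nu)=2^{-\min\{n\in\mathbb{N}\,:\,\omega_n\ne\nu_n\}+1}$ for $\omega\neq\nu$ (and $0$ for $\omega=\nu$), where $\mathbb{N}=\{1,2,\dots\}$. A subshift is a closed set $\Omega\subseteq\{0,1\}^{\mathbb{N}}$ that the left shift maps into itself; $\Omega^{*}$ denotes the set of all finite prefixes of its elements. A subshift $\Omega$ is of finite type if there is $M\in\mathbb{N}$ such that for all $\omega_1\cdots\omega_n,\ \xi_1\cdots\xi_m\in\Omega^{*}$ with $n\ge M$ and $m\ge1$ one has $\omega_{n-M+1}\cdots\omega_n\,\xi_1\cdots\xi_m\in\Omega^{*}$ if and only if $\omega_1\cdots\omega_n\,\xi_1\cdots\xi_m\in\Omega^{*}$. **Corollary.** Given $(\beta,\alpha)\in\Delta$, there exists a sequence $((\beta_n,\alpha_n))_{n\in\mathbb{N}}$ in $\Delta$ with $\lim_{n\to\infty}(\beta_n,\alpha_n)=(\beta,\alpha)$ such that (i) $\Omega_{\beta_n,\alpha_n}$ is a subshift of finite type for every $n$, (ii) the Hausdorff distance (with respect to $\mathscr{D}$)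 between $\Omega_{\beta,\alpha}$ and $\Omega_{\beta_n,\alpha_n}$ converges to zero as $n\to\infty$, and (iii) $\Omega_{\beta_n,\alpha_n}\subseteq\Omega_{\beta,\alpha}$ for every $n$. -/

import Mathlib

open Filter Topology

namespace IntermediateBeta

/-! Sequences are indexed from `0`: the letter `ω n` is the `(n + 1)`-st letter of the word. -/

/-- The left shift `σ(ω₁ω₂⋯) = ω₂ω₃⋯`. -/
def shift {m : ℕ} (ω : ℕ → Fin m) : ℕ → Fin m := fun n => ω (n + 1)

/-- The finite word `ω|ₙ = ω₁ ⋯ ωₙ`. -/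
def prefixWord {m : ℕ} (ω : ℕ → Fin m) (n : ℕ) : List (Fin m) :=
  List.ofFn fun i : Fin n => ω i

/-- The set `Ω^*` of all finite words which are prefixes of elements of `Ω`. -/
def language {m : ℕ} (Ω : Set (ℕ → Fin m)) : Set (List (Fin m)) :=
  {w | ∃ n : ℕ, ∃ ξ ∈ Ω, prefixWord ξ n = w}

/-- A subshift: a closed set (for the product of the discrete topologies) mapped into itself
by the shift. -/
def IsSubshift {m : ℕ} (Ω : Set (ℕ → Fin m)) : Prop :=
  IsClosed Ω ∧ ∀ ω ∈ Ω, shift ω ∈ Ω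

/-- A subshift of finite type: a subshift for which there is a memory `M ≥ 1` such that, for all
non-empty words `u`, `v` of the language with `|u| ≥ M`, the word `u v` belongs to the
language if and only if the word (last `M` letters of `u`) `v` does. -/
def IsSubshiftOfFiniteType {m : ℕ} (Ω : Set (ℕ → Fin m)) : Prop :=
  IsSubshift Ω ∧
    ∃ M : ℕ, 1 ≤ M ∧
      ∀ u ∈ language Ω, ∀ v ∈ language Ω, M ≤ u.length → 1 ≤ v.length →
        (u.drop (u.length - M) ++ v ∈ language Ω ↔ u ++ v ∈ language Ω)

/-- The word metric on `Λ^ℕ`; it induces the product topology. -/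
@[reducible] noncomputable def wordMetric (m : ℕ) : MetricSpace (ℕ → Fin m) :=
  PiNat.metricSpace (E := fun _ : ℕ => Fin m)

/-- For `ω ≠ ν` the word metric is `2 ^ (-k + 1)`, with `k = firstDiff + 1` the position, counted
from `1`, of the first letter in which the two words differ. -/
theorem wordMetric_dist {m : ℕ} (ω ν : ℕ → Fin m) (h : ω ≠ ν) :
    (wordMetric m).dist ω ν = (2 : ℝ) ^ (-((PiNat.firstDiff ω ν : ℤ) + 1) + 1) := by
  have e : (wordMetric m).dist ω ν = (1 / 2 : ℝ) ^ PiNat.firstDiff ω ν :=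
    PiNat.dist_eq_of_ne h
  have e' : (-((PiNat.firstDiff ω ν : ℤ) + 1) + 1) = -(PiNat.firstDiff ω ν : ℤ) := by ring
  rw [e, e', zpow_neg, zpow_natCast, one_div, inv_pow]

/-- The Hausdorff distance between sets of infinite words with respect to the word metric. -/
noncomputable def wordHausdorffDist {m : ℕ} (A B : Set (ℕ → Fin m)) : ℝ :=
  @Metric.hausdorffDist (ℕ → Fin m) (wordMetric m).toPseudoMetricSpace A B

/-- The parameter set `Δ` of pairs `(β, α)`. -/
def paramSet : Set (ℝ × ℝ) :=
  {q | q.1 ∈ Set.Ioo (1 : ℝ) 2 ∧ q.2 ∈ Set.Icc (0 : ℝ) (2 - q.1)}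

/-- The critical point `p = (1 - α) / β`. -/
noncomputable def critPt (β α : ℝ) : ℝ := (1 - α) / β

/-- The intermediate `β`-transformation `x ↦ β x + α mod 1`. -/
noncomputable def upperMap (β α : ℝ) (x : ℝ) : ℝ := Int.fract (β * x + α)

/-- The left-continuous version of the intermediate `β`-transformation. -/
noncomputable def lowerMap (β α : ℝ) (x : ℝ) : ℝ :=
  if x ≤ critPt β α then β * x + α else β * x + α - 1

/-- The upper expansion of `x`. -/
noncomputable def upperExpansion (β α : ℝ) (x : ℝ) : ℕ → Fin 2 :=
  fun n => if (upperMap β α)^[n] x < critPt β α then 0 else 1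

/-- The lower expansion of `x`. -/
noncomputable def lowerExpansion (β α : ℝ) (x : ℝ) : ℕ → Fin 2 :=
  fun n => if (lowerMap β α)^[n] x ≤ critPt β α then 0 else 1

theorem tendsto_upperMap_left {β α z : ℝ} (h : (β, α) ∈ paramSet) (hz : z ∈ Set.Ioc (0 : ℝ) 1) :
    Tendsto (upperMap β α) (𝓝[<] z) (𝓝[<] (lowerMap β α z)) ∧
      lowerMap β α z ∈ Set.Ioc (0 : ℝ) 1 := by
  obtain ⟨⟨hb1, hb2⟩, ha0, ha1⟩ := h
  obtain ⟨hz0, hz1⟩ := hz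
  simp only at hb1 hb2 ha0 ha1
  have hb : 0 < β := by linarith
  have hp : ∀ y : ℝ, y ≤ critPt β α ↔ β * y + α ≤ 1 := fun y => by
    rw [critPt, le_div_iff₀ hb]
    constructor <;> intro hy <;> linarith
  have hbz : β * z ≤ β := by nlinarith
  have hbz0 : 0 < β * z := by positivity
  have hid : Tendsto (fun y : ℝ => y) (𝓝[<] z) (𝓝 z) := tendsto_id.mono_left nhdsWithin_le_nhds
  have hlin : Tendsto (fun y : ℝ => β * y + α) (𝓝[<] z) (𝓝 (β * z + α)) :=
    (hid.const_mul β).add_const α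
  have hpos : ∀ᶠ y in 𝓝[<] z, 0 < y := hid.eventually_const_lt hz0
  by_cases hc : z ≤ critPt β α
  · have hl : lowerMap β α z = β * z + α := if_pos hc
    have hc' := (hp z).1 hc
    rw [hl]
    have key : ∀ᶠ y in 𝓝[<] z, upperMap β α y = β * y + α ∧ β * y + α < β * z + α := by
      filter_upwards [hpos, self_mem_nhdsWithin] with y hy0 (hyz : y < z)
      have h1 : β * y < β * z := mul_lt_mul_of_pos_left hyz hb
      have h2 : 0 < β * y := mul_pos hb hy0
      exact ⟨Int.fract_eq_self.2 ⟨by linarith, by linarith⟩, by linarith⟩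
    refine ⟨tendsto_nhdsWithin_iff.2 ⟨hlin.congr' (key.mono fun y hy => hy.1.symm), ?_⟩,
      by linarith, hc'⟩
    filter_upwards [key] with y hy
    rw [hy.1]
    exact hy.2
  · have hl : lowerMap β α z = β * z + α - 1 := if_neg hc
    have hc' : 1 < β * z + α := lt_of_not_ge fun hh => hc ((hp z).2 hh)
    rw [hl]
    have key : ∀ᶠ y in 𝓝[<] z,
        upperMap β α y = β * y + α - 1 ∧ β * y + α - 1 < β * z + α - 1 := by
      filter_upwards [hlin.eventually_const_lt hc', self_mem_nhdsWithin] with y hy1 (hyz : y < z)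
      have h1 : β * y < β * z := mul_lt_mul_of_pos_left hyz hb
      refine ⟨Int.fract_eq_iff.2 ⟨by linarith, by linarith, 1, by push_cast; ring⟩, by linarith⟩
    refine ⟨tendsto_nhdsWithin_iff.2
      ⟨(hlin.sub_const 1).congr' (key.mono fun y hy => hy.1.symm), ?_⟩, by linarith, by linarith⟩
    filter_upwards [key] with y hy
    rw [hy.1]
    exact hy.2

/-- The lower expansion of `x ∈ (0, 1]` is the limit of the upper expansions of `y` as `y`
increases to `x`. -/
theorem tendsto_upperExpansion {β α x : ℝ} (h : (β, α) ∈ paramSet) (hx : x ∈ Set.Ioc (0 : ℝ) 1) :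
    Tendsto (upperExpansion β α) (𝓝[<] x) (𝓝 (lowerExpansion β α x)) := by
  have hit : ∀ n : ℕ,
      Tendsto ((upperMap β α)^[n]) (𝓝[<] x) (𝓝[<] ((lowerMap β α)^[n] x)) ∧
        (lowerMap β α)^[n] x ∈ Set.Ioc (0 : ℝ) 1 := by
    intro n
    induction n with
    | zero => exact ⟨tendsto_id, hx⟩
    | succ k ih =>
      have hk := tendsto_upperMap_left h ih.2
      rw [Function.iterate_succ', Function.iterate_succ']
      exact ⟨hk.1.comp ih.1, hk.2⟩
  refine tendsto_pi_nhds.2 fun n => ?_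
  have hn := tendsto_nhdsWithin_iff.1 (hit n).1
  refine tendsto_const_nhds.congr' ?_
  by_cases hc : (lowerMap β α)^[n] x ≤ critPt β α
  · filter_upwards [hn.2] with y (hy : (upperMap β α)^[n] y < (lowerMap β α)^[n] x)
    simp only [lowerExpansion, upperExpansion]
    rw [if_pos hc, if_pos (lt_of_lt_of_le hy hc)]
  · filter_upwards [hn.1.eventually_const_lt (lt_of_not_ge hc)] with y hy
    simp only [lowerExpansion, upperExpansion]
    rw [if_neg hc, if_neg (not_lt.2 hy.le)]

/-- The intermediate `β`-shift `Ω_{β,α}`, the union of the image of `[0, 1)` under the upper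
expansion and the image of `(0, 1]` under the lower expansion. -/
noncomputable def betaShift (β α : ℝ) : Set (ℕ → Fin 2) :=
  upperExpansion β α '' Set.Ico 0 1 ∪ lowerExpansion β α '' Set.Ioc 0 1

end IntermediateBeta

/-!
Write `u = τ⁺(0)` and `v = τ⁻(1)`, with orbits `x i = (T⁺)^i 0` and `y i = (T⁻)^i 1`. The shift
consists of the words all of whose shifts lie between `u` and `v` in the lexicographic order
(`mem_betaShift_iff`). Hence increasing `u` and decreasing `v` shrinks the shift
(`betaShift_subset`), and the shift is of finite type as soon as `u` and `v` are both periodic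
(`isSubshiftOfFiniteType_of_periodic`). Moreover every prefix of a word of the shift survives small
changes of the parameters, so that for parameters `q → (β, α)` with smaller shifts the Hausdorff
distance tends to zero (`tendsto_wordHausdorffDist`). It remains to find, arbitrarily close to
`(β, α)`, parameters with larger `u`, smaller `v`, both periodic (`frequently_inner_isPeriodic`).

Move along a path `t ↦ (β - t, α + A t * t)`. As long as the coding is unchanged, the `n`-th point
of the orbit of `0` moves by `t β_t ^ (n - 1) ∑_{i < n} β_t ^ (-i) (A t - x i)` where
`β_t = β - t`, and likewise for the orbit of `1`. If `A 0` exceeds the mean of the `x i` with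
weights `β ^ (-i)`, these displacements are eventually positive and grow exponentially; therefore
`u` increases (`IsPath.eventually_kneadZero_lt`), and for arbitrarily small `t` the orbit of `0`
passes exactly through the critical point, which makes `u` periodic
(`IsPath.frequently_isPeriodic`). In the same way `v` decreases if `A 0` is less than the mean of
the `y i`. Both can be achieved at once because the mean of the `y i` exceeds that of the `x i`:
`∑ β ^ (-i) (y i - x i)` is the total mass of the Parry density, and it is positive
(`tsum_orbitOne_sub_orbitZero_pos`). With a constant direction between the two means `u` is made
periodic first. Once `u` is periodic, the direction `A t` is taken to be the mean, with weights
`β_t ^ (-i)`, of the `x i` over a period; this keeps `u` fixed, and `v` decreases until it is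
periodic too.

The reflection `x ↦ 1 - x` exchanges `T⁺` and `T⁻`, so that most statements are proved for `u` and
transferred to `v`.
-/

namespace IntermediateBeta

/-! ### Codings of orbits -/

/-- `IsCoding β α ω x` says that `x` is an orbit in `[0, 1]` of the two-branched map
`t ↦ β t + α - d`, `d ∈ {0, 1}`, where `ω n` is the branch used at time `n`. At the critical point
both branches are allowed, so that the orbits of `T⁺` and of `T⁻` are both covered: the first are
the codings with `x n < 1` for all `n`, the second those with `0 < x n` for all `n`. -/
structure IsCoding (β α : ℝ) (ω : ℕ → Fin 2) (x : ℕ → ℝ) : Prop where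
  mem : ∀ n, x n ∈ Set.Icc (0 : ℝ) 1
  step : ∀ n, x (n + 1) = β * x n + α - ((ω n : ℕ) : ℝ)

theorem fin_two_cases (d : Fin 2) : d = 0 ∨ d = 1 := by omega

theorem iterate_shift (ω : ℕ → Fin 2) (n k : ℕ) : (shift^[n] ω) k = ω (n + k) := by
  induction n generalizing ω with
  | zero => simp
  | succ n ih =>
    rw [Function.iterate_succ_apply, ih]
    simp only [shift]
    congr 1
    omega

theorem one_lt_of_mem {β α : ℝ} (h : (β, α) ∈ paramSet) : 1 < β := h.1.1

theorem lt_critPt_iff {β α : ℝ} (h : 1 < β) (x : ℝ) : x < critPt β α ↔ β * x + α < 1 := by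
  rw [critPt, lt_div_iff₀ (by linarith)]
  constructor <;> intro hy <;> linarith

theorem le_critPt_iff {β α : ℝ} (h : 1 < β) (x : ℝ) : x ≤ critPt β α ↔ β * x + α ≤ 1 := by
  rw [critPt, le_div_iff₀ (by linarith)]
  constructor <;> intro hy <;> linarith

theorem upperExpansion_eq_zero_iff {β α : ℝ} (h : 1 < β) (x : ℝ) (n : ℕ) :
    upperExpansion β α x n = 0 ↔ β * (upperMap β α)^[n] x + α < 1 := by
  rw [← lt_critPt_iff h, upperExpansion]
  split_ifs with hc <;> simp [hc]

theorem lowerExpansion_eq_zero_iff {β α : ℝ} (h : 1 < β) (x : ℝ) (n : ℕ) :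
    lowerExpansion β α x n = 0 ↔ β * (lowerMap β α)^[n] x + α ≤ 1 := by
  rw [← le_critPt_iff h, lowerExpansion]
  split_ifs with hc <;> simp [hc]

theorem upperMap_mem (β α x : ℝ) : upperMap β α x ∈ Set.Ico (0 : ℝ) 1 :=
  ⟨Int.fract_nonneg _, Int.fract_lt_one _⟩

theorem upperMap_iterate_mem (β α : ℝ) {x : ℝ} (hx : x ∈ Set.Ico (0 : ℝ) 1) (n : ℕ) :
    (upperMap β α)^[n] x ∈ Set.Ico (0 : ℝ) 1 := by
  induction n with
  | zero => exact hx
  | succ n ih => rw [Function.iterate_succ_apply']; exact upperMap_mem _ _ _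

theorem lowerMap_iterate_mem {β α : ℝ} (h : (β, α) ∈ paramSet) {x : ℝ}
    (hx : x ∈ Set.Ioc (0 : ℝ) 1) (n : ℕ) : (lowerMap β α)^[n] x ∈ Set.Ioc (0 : ℝ) 1 := by
  induction n with
  | zero => exact hx
  | succ n ih => rw [Function.iterate_succ_apply']; exact (tendsto_upperMap_left h ih).2

theorem isCoding_upper {β α : ℝ} (h : (β, α) ∈ paramSet) {x : ℝ} (hx : x ∈ Set.Ico (0 : ℝ) 1) :
    IsCoding β α (upperExpansion β α x) fun n => (upperMap β α)^[n] x := by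
  refine ⟨fun n => Set.Ico_subset_Icc_self (upperMap_iterate_mem β α hx n), fun n => ?_⟩
  have hm := upperMap_iterate_mem β α hx n
  have hz := upperExpansion_eq_zero_iff (α := α) (one_lt_of_mem h) x n
  obtain ⟨⟨hb1, hb2⟩, ha0, ha1⟩ := h
  simp only at hb1 hb2 ha0 ha1
  simp only [Function.iterate_succ_apply']
  set y := (upperMap β α)^[n] x
  have h0 : 0 ≤ β * y := mul_nonneg (by linarith) hm.1
  have h1 : β * y < β := by nlinarith [hm.2]
  rcases fin_two_cases (upperExpansion β α x n) with hd | hd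
  · rw [hd, upperMap, Int.fract_eq_self.2 ⟨by linarith, hz.1 hd⟩]
    simp
  · have : 1 ≤ β * y + α := by
      by_contra hc
      rw [hz.2 (not_le.1 hc)] at hd
      exact absurd hd (by decide)
    rw [hd, upperMap]
    exact Int.fract_eq_iff.2 ⟨by simp; linarith, by simp; linarith, 1, by simp⟩

theorem isCoding_lower {β α : ℝ} (h : (β, α) ∈ paramSet) {x : ℝ} (hx : x ∈ Set.Ioc (0 : ℝ) 1) :
    IsCoding β α (lowerExpansion β α x) fun n => (lowerMap β α)^[n] x := by
  refine ⟨fun n => Set.Ioc_subset_Icc_self (lowerMap_iterate_mem h hx n), fun n => ?_⟩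
  simp only [Function.iterate_succ_apply', lowerExpansion]
  rw [lowerMap]
  split_ifs <;> simp

section Coding

variable {β α : ℝ} {ω ν : ℕ → Fin 2} {x y : ℕ → ℝ}

theorem IsCoding.shift_iterate (h : IsCoding β α ω x) (k : ℕ) :
    IsCoding β α (shift^[k] ω) fun n => x (k + n) :=
  ⟨fun n => h.mem _, fun n => by rw [iterate_shift, ← add_assoc]; exact h.step _⟩

theorem IsCoding.sub_eq (hx : IsCoding β α ω x) (hy : IsCoding β α ν y) {n : ℕ}
    (hn : ∀ i < n, ω i = ν i) : y n - x n = β ^ n * (y 0 - x 0) := by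
  induction n with
  | zero => simp
  | succ n ih =>
    rw [hx.step, hy.step, hn n (by omega), pow_succ]
    linear_combination β * ih fun i hi => hn i (by omega)

/-- Distances between orbits with the same coding grow like `β ^ n`, so an orbit is determined by
its coding. -/
theorem IsCoding.orbit_unique (hβ : 1 < β) (hx : IsCoding β α ω x) (hy : IsCoding β α ω y) :
    x = y := by
  have h0 : ∀ {ω : ℕ → Fin 2} {x y : ℕ → ℝ},
      IsCoding β α ω x → IsCoding β α ω y → x 0 = y 0 := by
    intro ω x y hx hy
    by_contra hne
    obtain ⟨n, hn⟩ := pow_unbounded_of_one_lt (1 / |y 0 - x 0|) hβ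
    have hp : 0 < |y 0 - x 0| := abs_pos.2 (sub_ne_zero.2 (Ne.symm hne))
    rw [div_lt_iff₀ hp] at hn
    have h1 := hx.sub_eq hy (n := n) fun _ _ => rfl
    have h2 : |y n - x n| ≤ 1 :=
      abs_le.2 ⟨by linarith [(hy.mem n).1, (hx.mem n).2], by linarith [(hy.mem n).2, (hx.mem n).1]⟩
    rw [h1, abs_mul, abs_of_pos (by positivity)] at h2
    linarith
  funext n
  exact h0 (hx.shift_iterate n) (hy.shift_iterate n)

theorem exists_first_ne {ω ν : ℕ → Fin 2} (h : ω ≠ ν) :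
    ∃ n, (∀ i < n, ω i = ν i) ∧ ω n ≠ ν n := by
  classical
  have hex : ∃ n, ω n ≠ ν n := Function.ne_iff.1 h
  exact ⟨Nat.find hex, fun i hi => not_not.1 (Nat.find_min hex hi), Nat.find_spec hex⟩

theorem toLex_lt_iff {ω ν : ℕ → Fin 2} :
    toLex ω < toLex ν ↔ ∃ n, (∀ i < n, ω i = ν i) ∧ ω n = 0 ∧ ν n = 1 := by
  refine exists_congr fun n => and_congr Iff.rfl ?_
  change ω n < ν n ↔ _
  omega

/-- Codings are monotone in the starting point, whichever branch is chosen at the critical point. -/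
theorem IsCoding.toLex_lt (hβ : 1 < β) (hx : IsCoding β α ω x) (hy : IsCoding β α ν y)
    (h : x 0 < y 0) : toLex ω < toLex ν := by
  have hne : ω ≠ ν := by
    rintro rfl
    rw [hx.orbit_unique hβ hy] at h
    exact lt_irrefl _ h
  obtain ⟨n, hn, hd⟩ := exists_first_ne hne
  refine toLex_lt_iff.2 ⟨n, hn, ?_⟩
  have h1 := hx.sub_eq hy hn
  have h2 : 0 < β ^ n * (y 0 - x 0) := mul_pos (by positivity) (by linarith)
  have h3 : β * (y n - x n) > 0 := mul_pos (by linarith) (by linarith)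
  have hx1 := hx.step n
  have hy1 := hy.step n
  have hxm := (hx.mem (n + 1)).1
  have hym := (hy.mem (n + 1)).2
  rcases fin_two_cases (ω n) with e | e <;> rcases fin_two_cases (ν n) with e' | e'
  · exact absurd (e.trans e'.symm) hd
  · exact ⟨e, e'⟩
  · rw [e] at hx1
    rw [e'] at hy1
    simp at hx1 hy1
    linarith
  · exact absurd (e.trans e'.symm) hd

/-- A coding whose orbit avoids `1` is an upper expansion. -/
theorem IsCoding.eq_upper (hβ : (β, α) ∈ paramSet) (hx : IsCoding β α ω x) (h1 : ∀ n, x n < 1) :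
    ω = upperExpansion β α (x 0) ∧ ∀ n, x n = (upperMap β α)^[n] (x 0) := by
  have key : ∀ n, upperMap β α (x n) = x (n + 1) := by
    intro n
    refine Int.fract_eq_iff.2 ⟨(hx.mem _).1, h1 _, ((ω n : ℕ) : ℤ), ?_⟩
    rw [hx.step]
    push_cast
    ring
  have horb : ∀ n, x n = (upperMap β α)^[n] (x 0) := by
    intro n
    induction n with
    | zero => rfl
    | succ n ih => rw [Function.iterate_succ_apply', ← ih, key]
  refine ⟨funext fun n => ?_, horb⟩
  have hz := upperExpansion_eq_zero_iff (α := α) (one_lt_of_mem hβ) (x 0) n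
  rw [← horb] at hz
  have hs := hx.step n
  rcases fin_two_cases (ω n) with e | e
  · rw [e] at hs ⊢
    simp at hs
    exact (hz.2 (by linarith [h1 (n + 1)])).symm
  · rcases fin_two_cases (upperExpansion β α (x 0) n) with e' | e'
    · rw [e] at hs
      simp at hs
      linarith [hz.1 e', (hx.mem (n + 1)).1]
    · rw [e, e']

/-- A coding whose orbit avoids `0` is a lower expansion. -/
theorem IsCoding.eq_lower (hβ : (β, α) ∈ paramSet) (hx : IsCoding β α ω x) (h0 : ∀ n, 0 < x n) :
    ω = lowerExpansion β α (x 0) ∧ ∀ n, x n = (lowerMap β α)^[n] (x 0) := by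
  have hb := one_lt_of_mem hβ
  have key : ∀ n, lowerMap β α (x n) = x (n + 1) := by
    intro n
    have hs := hx.step n
    rw [lowerMap, if_congr (le_critPt_iff hb _) rfl rfl]
    rcases fin_two_cases (ω n) with e | e
    · rw [e] at hs
      simp at hs
      rw [if_pos (by linarith [(hx.mem (n + 1)).2]), hs]
    · rw [e] at hs
      simp at hs
      rw [if_neg (by linarith [h0 (n + 1)]), hs]
  have horb : ∀ n, x n = (lowerMap β α)^[n] (x 0) := by
    intro n
    induction n with
    | zero => rfl
    | succ n ih => rw [Function.iterate_succ_apply', ← ih, key]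
  refine ⟨funext fun n => ?_, horb⟩
  have hz := lowerExpansion_eq_zero_iff (α := α) hb (x 0) n
  rw [← horb] at hz
  have hs := hx.step n
  rcases fin_two_cases (ω n) with e | e
  · rw [e] at hs ⊢
    simp at hs
    exact (hz.2 (by linarith [(hx.mem (n + 1)).2])).symm
  · rcases fin_two_cases (lowerExpansion β α (x 0) n) with e' | e'
    · rw [e] at hs
      simp at hs
      linarith [hz.1 e', h0 (n + 1)]
    · rw [e, e']

end Coding

/-! ### Reflection -/

/-- The exchange of the letters `0` and `1`. -/
def flip (ω : ℕ → Fin 2) : ℕ → Fin 2 := fun n => 1 - ω n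

theorem flip_flip (ω : ℕ → Fin 2) : flip (flip ω) = ω := by
  funext n
  simp [flip]

theorem toLex_flip_lt {ω ν : ℕ → Fin 2} :
    toLex (flip ω) < toLex (flip ν) ↔ toLex ν < toLex ω := by
  simp only [toLex_lt_iff, flip]
  refine exists_congr fun n => and_congr (forall₂_congr fun i _ => ?_) ?_
  · omega
  · omega

theorem IsCoding.reflect {β α : ℝ} {ω : ℕ → Fin 2} {x : ℕ → ℝ} (h : IsCoding β α ω x) :
    IsCoding β (2 - β - α) (flip ω) fun n => 1 - x n := by
  refine ⟨fun n => ⟨by linarith [(h.mem n).2], by linarith [(h.mem n).1]⟩, fun n => ?_⟩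
  rw [h.step, flip]
  rcases fin_two_cases (ω n) with e | e <;> rw [e] <;> simp <;> ring

theorem reflect_mem {β α : ℝ} (h : (β, α) ∈ paramSet) : (β, 2 - β - α) ∈ paramSet := by
  obtain ⟨hb, ha0, ha1⟩ := h
  exact ⟨hb, by simp at *; linarith, by simp at *; linarith⟩

/-- The upper kneading sequence `τ⁺(0)`, the least element of the shift. -/
noncomputable def kneadZero (β α : ℝ) : ℕ → Fin 2 := upperExpansion β α 0

/-- The lower kneading sequence `τ⁻(1)`, the greatest element of the shift. -/
noncomputable def kneadOne (β α : ℝ) : ℕ → Fin 2 := lowerExpansion β α 1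

/-- The orbit of `0` under `T⁺`. -/
noncomputable def orbitZero (β α : ℝ) (n : ℕ) : ℝ := (upperMap β α)^[n] 0

/-- The orbit of `1` under `T⁻`. -/
noncomputable def orbitOne (β α : ℝ) (n : ℕ) : ℝ := (lowerMap β α)^[n] 1

section Kneading

variable {β α : ℝ}

@[simp] theorem orbitZero_zero (β α : ℝ) : orbitZero β α 0 = 0 := rfl

@[simp] theorem orbitOne_zero (β α : ℝ) : orbitOne β α 0 = 1 := rfl

theorem orbitZero_lt_one (β α : ℝ) (n : ℕ) : orbitZero β α n < 1 :=
  (upperMap_iterate_mem β α ⟨le_rfl, one_pos⟩ n).2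

theorem isCoding_kneadZero (h : (β, α) ∈ paramSet) : IsCoding β α (kneadZero β α) (orbitZero β α) :=
  isCoding_upper h ⟨le_rfl, one_pos⟩

theorem isCoding_kneadOne (h : (β, α) ∈ paramSet) : IsCoding β α (kneadOne β α) (orbitOne β α) :=
  isCoding_lower h ⟨one_pos, le_rfl⟩

theorem orbitOne_pos (h : (β, α) ∈ paramSet) (n : ℕ) : 0 < orbitOne β α n :=
  (lowerMap_iterate_mem h ⟨one_pos, le_rfl⟩ n).1

/-- The reflection `x ↦ 1 - x` carries `T⁻` for `(β, α)` to `T⁺` for `(β, 2 - β - α)`. -/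
theorem kneadZero_reflect (h : (β, α) ∈ paramSet) :
    kneadZero β (2 - β - α) = flip (kneadOne β α) ∧
      ∀ n, orbitZero β (2 - β - α) n = 1 - orbitOne β α n := by
  have := (isCoding_kneadOne h).reflect.eq_upper (reflect_mem h)
    fun n => by linarith [orbitOne_pos h n]
  simp only [orbitOne_zero, sub_self] at this
  exact ⟨this.1.symm, fun n => (this.2 n).symm⟩

theorem kneadOne_reflect (h : (β, α) ∈ paramSet) : kneadOne β (2 - β - α) = flip (kneadZero β α) := by
  have := (kneadZero_reflect (reflect_mem h)).1
  rw [show 2 - β - (2 - β - α) = α by ring] at this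
  rw [this, flip_flip]

/-! ### The shift in terms of its kneading sequences -/

/-- Every word codes the bounded orbit of `∑ (ω i - α) β ^ (-(i + 1))`. -/
theorem exists_bounded_orbit (hβ : 1 < β) (α : ℝ) (ω : ℕ → Fin 2) :
    ∃ x : ℕ → ℝ, (∀ n, x (n + 1) = β * x n + α - ((ω n : ℕ) : ℝ)) ∧ ∃ C, ∀ n, |x n| ≤ C := by
  have hβ0 : 0 < β := by linarith
  have hr : β⁻¹ < 1 := inv_lt_one_of_one_lt₀ hβ
  have hg : Summable fun i : ℕ => (1 + |α|) * β⁻¹ ^ (i + 1) :=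
    ((summable_nat_add_iff 1).2 (summable_geometric_of_lt_one (by positivity) hr)).mul_left _
  have hb : ∀ n i, ‖(((ω (n + i) : ℕ) : ℝ) - α) * β⁻¹ ^ (i + 1)‖ ≤ (1 + |α|) * β⁻¹ ^ (i + 1) := by
    intro n i
    rw [norm_mul, Real.norm_of_nonneg (r := β⁻¹ ^ (i + 1)) (by positivity)]
    gcongr
    refine (norm_sub_le _ _).trans ?_
    rw [Real.norm_eq_abs α]
    rcases fin_two_cases (ω (n + i)) with e | e <;> rw [e] <;> simp
  have hs : ∀ n, Summable fun i => (((ω (n + i) : ℕ) : ℝ) - α) * β⁻¹ ^ (i + 1) := fun n =>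
    Summable.of_norm_bounded hg (hb n)
  refine ⟨fun n => ∑' i, (((ω (n + i) : ℕ) : ℝ) - α) * β⁻¹ ^ (i + 1), fun n => ?_,
    _, fun n => tsum_of_norm_bounded hg.hasSum (hb n)⟩
  have h1 := (hs n).tsum_eq_zero_add
  have h2 : ∑' i, (((ω (n + (i + 1)) : ℕ) : ℝ) - α) * β⁻¹ ^ (i + 1 + 1) =
      β⁻¹ * ∑' i, (((ω (n + 1 + i) : ℕ) : ℝ) - α) * β⁻¹ ^ (i + 1) := by
    rw [← tsum_mul_left]
    refine tsum_congr fun i => ?_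
    rw [show n + (i + 1) = n + 1 + i by ring]
    ring
  simp only at h1 ⊢
  rw [h1, h2]
  simp only [add_zero, zero_add, pow_one]
  field_simp
  ring

/-- A bounded orbit stays nonnegative if all shifts of its coding are at least `τ⁺(0)`: at the
first letter where the coding exceeds `τ⁺(0)`, the orbit of `0` is mapped below `1`, whence
`x n ≥ β ^ (-k) * x (n + k)` for some `k ≥ 1`. -/
theorem orbit_nonneg (h : (β, α) ∈ paramSet) {ω : ℕ → Fin 2} {x : ℕ → ℝ} {C : ℝ}
    (hx : ∀ n, x (n + 1) = β * x n + α - ((ω n : ℕ) : ℝ)) (hC : ∀ n, |x n| ≤ C)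
    (hω : ∀ n, toLex (kneadZero β α) ≤ toLex (shift^[n] ω)) (n : ℕ) : 0 ≤ x n := by
  have hβ := one_lt_of_mem h
  have hβ0 : 0 < β := by linarith
  have hC0 : 0 ≤ C := (abs_nonneg _).trans (hC 0)
  have hcod := isCoding_kneadZero h
  have hsub : ∀ n k, (∀ i < k, kneadZero β α i = ω (n + i)) →
      x (n + k) - orbitZero β α k = β ^ k * x n := by
    intro n k hk
    induction k with
    | zero => simp
    | succ k ih =>
      rw [← add_assoc, hx, hcod.step, hk k (by omega), pow_succ]
      linear_combination β * ih fun i hi => hk i (by omega)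
  have key : ∀ j n, -(C + 1) ≤ β ^ j * x n := by
    intro j
    induction j with
    | zero => intro n; linarith [(abs_le.1 (hC n)).1, pow_zero β]
    | succ j ih =>
      intro n
      rcases (hω n).eq_or_lt with he | hlt
      · have he' : ∀ i, kneadZero β α i = ω (n + i) := fun i => by
          rw [← iterate_shift ω n i]; exact congrFun (toLex.injective he) i
        rw [← hsub n (j + 1) fun i _ => he' i]
        linarith [(abs_le.1 (hC (n + (j + 1)))).1, orbitZero_lt_one β α (j + 1)]
      · obtain ⟨k, hk, hk0, hk1⟩ := toLex_lt_iff.1 hlt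
        simp only [iterate_shift] at hk hk1
        have h1 := hsub n k hk
        have h2 := hx (n + k)
        have h3 := hcod.step k
        have h4 := orbitZero_lt_one β α (k + 1)
        rw [hk1] at h2
        rw [hk0] at h3
        simp at h2 h3
        have h5 : x (n + k + 1) ≤ β ^ (k + 1) * x n := by
          rw [pow_succ]
          have : x (n + k + 1) = β * (β ^ k * x n) + β * orbitZero β α k + α - 1 := by
            rw [h2, ← h1]; ring
          linarith
        by_cases hn : 0 ≤ x n
        · have : 0 ≤ β ^ (j + 1) * x n := by positivity
          linarith
        · have h6 : β ^ j * x (n + k + 1) ≤ β ^ j * (β ^ (k + 1) * x n) :=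
            mul_le_mul_of_nonneg_left h5 (by positivity)
          have h7 : β ^ j * (β ^ (k + 1) * x n) ≤ β ^ (j + 1) * x n := by
            have : β ^ (j + 1) ≤ β ^ j * β ^ (k + 1) := by
              rw [← pow_add]
              exact pow_le_pow_right₀ hβ.le (by omega)
            nlinarith
          linarith [ih (n + k + 1)]
  by_contra hn
  have hp : 0 < -x n := by linarith
  obtain ⟨j, hj⟩ := pow_unbounded_of_one_lt ((C + 1) / (-x n)) hβ
  rw [div_lt_iff₀ hp] at hj
  linarith [key j n]

theorem eq_kneadZero_of_orbit_eq_zero (h : (β, α) ∈ paramSet) {ω : ℕ → Fin 2} {x : ℕ → ℝ}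
    (hx : IsCoding β α ω x) (h0 : x 0 = 0) (hω : toLex (kneadZero β α) ≤ toLex ω) :
    ω = kneadZero β α := by
  rcases hω.eq_or_lt with he | hlt
  · exact (toLex.injective he).symm
  · exfalso
    obtain ⟨k, hk, hk0, hk1⟩ := toLex_lt_iff.1 hlt
    have hcod := isCoding_kneadZero h
    have h1 := hcod.sub_eq hx hk
    have h2 := hx.step k
    have h3 := hcod.step k
    rw [hk1] at h2
    rw [hk0] at h3
    rw [h0, orbitZero_zero, sub_zero, mul_zero] at h1
    simp at h2 h3
    have h4 := orbitZero_lt_one β α (k + 1)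
    have h5 := (hx.mem (k + 1)).1
    rw [h2, sub_eq_zero.1 h1] at h5
    linarith

theorem toLex_le_flip {ω ν : ℕ → Fin 2} (h : toLex ω ≤ toLex ν) :
    toLex (flip ν) ≤ toLex (flip ω) := by
  rcases h.eq_or_lt with he | hlt
  · rw [toLex.injective he]
  · exact (toLex_flip_lt.2 hlt).le

theorem iterate_shift_flip (ω : ℕ → Fin 2) (n : ℕ) : shift^[n] (flip ω) = flip (shift^[n] ω) := by
  funext k
  simp [iterate_shift, flip]

theorem exists_isCoding (h : (β, α) ∈ paramSet) {ω : ℕ → Fin 2}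
    (hω : ∀ n, toLex (kneadZero β α) ≤ toLex (shift^[n] ω) ∧
      toLex (shift^[n] ω) ≤ toLex (kneadOne β α)) : ∃ x, IsCoding β α ω x := by
  obtain ⟨x, hx, C, hC⟩ := exists_bounded_orbit (one_lt_of_mem h) α ω
  refine ⟨x, fun n => ⟨orbit_nonneg h hx hC (fun n => (hω n).1) n, ?_⟩, hx⟩
  have := orbit_nonneg (reflect_mem h) (ω := flip ω) (x := fun n => 1 - x n) (C := 1 + C)
    (fun n => ?_) (fun n => ?_) (fun n => ?_) n
  · linarith
  · rw [hx, flip]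
    rcases fin_two_cases (ω n) with e | e <;> rw [e] <;> simp <;> ring
  · refine (abs_sub _ _).trans ?_
    rw [abs_one]
    linarith [hC n]
  · rw [(kneadZero_reflect h).1, iterate_shift_flip]
    exact toLex_le_flip (hω n).2

theorem eq_kneadOne_of_orbit_eq_one (h : (β, α) ∈ paramSet) {ω : ℕ → Fin 2} {x : ℕ → ℝ}
    (hx : IsCoding β α ω x) (h1 : x 0 = 1) (hω : toLex ω ≤ toLex (kneadOne β α)) :
    ω = kneadOne β α := by
  have := eq_kneadZero_of_orbit_eq_zero (reflect_mem h) hx.reflect (by simp [h1])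
    (by rw [(kneadZero_reflect h).1]; exact toLex_le_flip hω)
  rw [(kneadZero_reflect h).1] at this
  rw [← flip_flip ω, this, flip_flip]

theorem IsCoding.knead_bounds (h : (β, α) ∈ paramSet) {ω : ℕ → Fin 2} {x : ℕ → ℝ}
    (hx : IsCoding β α ω x) (h1 : ∀ n, x n < 1) :
    toLex (kneadZero β α) ≤ toLex ω ∧ toLex ω ≤ toLex (kneadOne β α) := by
  constructor
  · rcases (hx.mem 0).1.eq_or_lt with h0 | h0
    · rw [(hx.eq_upper h h1).1, ← h0]
      rfl
    · exact ((isCoding_kneadZero h).toLex_lt (one_lt_of_mem h) hx h0).le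
  · exact (hx.toLex_lt (one_lt_of_mem h) (isCoding_kneadOne h) (h1 0)).le

/-- The shift consists of the words all of whose shifts lie between the two kneading sequences. -/
theorem mem_betaShift_iff (h : (β, α) ∈ paramSet) {ω : ℕ → Fin 2} :
    ω ∈ betaShift β α ↔ ∀ n, toLex (kneadZero β α) ≤ toLex (shift^[n] ω) ∧
      toLex (shift^[n] ω) ≤ toLex (kneadOne β α) := by
  have hβ := one_lt_of_mem h
  constructor
  · rintro (⟨x, hx, rfl⟩ | ⟨x, hx, rfl⟩) n
    · exact ((isCoding_upper h hx).shift_iterate n).knead_bounds h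
        fun k => (upperMap_iterate_mem β α hx _).2
    · have := ((isCoding_lower h hx).shift_iterate n).reflect.knead_bounds (reflect_mem h)
        fun k => by linarith [(lowerMap_iterate_mem h hx (n + k)).1]
      rw [(kneadZero_reflect h).1, kneadOne_reflect h] at this
      have h1 := toLex_le_flip this.1
      have h2 := toLex_le_flip this.2
      rw [flip_flip, flip_flip] at h1 h2
      exact ⟨h2, h1⟩
  · intro hω
    obtain ⟨x, hx⟩ := exists_isCoding h hω
    by_cases hup : ∀ n, x n < 1
    · exact Or.inl ⟨x 0, ⟨(hx.mem 0).1, hup 0⟩, (hx.eq_upper h hup).1.symm⟩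
    by_cases hlo : ∀ n, 0 < x n
    · exact Or.inr ⟨x 0, ⟨hlo 0, (hx.mem 0).2⟩, (hx.eq_lower h hlo).1.symm⟩
    -- An orbit through both `0` and `1` would force the orbit of `0` under `T⁺` to reach `1`, or
    -- the orbit of `1` under `T⁻` to reach `0`.
    exfalso
    push Not at hup hlo
    obtain ⟨n, hn⟩ := hup
    obtain ⟨m, hm⟩ := hlo
    have hn1 : x n = 1 := le_antisymm (hx.mem n).2 hn
    have hm0 : x m = 0 := le_antisymm hm (hx.mem m).1
    have cn := hx.shift_iterate n
    have cm := hx.shift_iterate m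
    have en := eq_kneadOne_of_orbit_eq_one h cn hn1 (hω n).2
    have em := eq_kneadZero_of_orbit_eq_zero h cm hm0 (hω m).1
    rw [en] at cn
    rw [em] at cm
    have on := congrFun (cn.orbit_unique hβ (isCoding_kneadOne h)) (m - n)
    have om := congrFun (cm.orbit_unique hβ (isCoding_kneadZero h)) (n - m)
    rcases le_total n m with hnm | hnm
    · rw [Nat.add_sub_cancel' hnm, hm0] at on
      linarith [orbitOne_pos h (m - n)]
    · rw [Nat.add_sub_cancel' hnm, hn1] at om
      linarith [orbitZero_lt_one β α (n - m)]

theorem isClosed_setOf_toLex_le (ν : ℕ → Fin 2) (n : ℕ) :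
    IsClosed {ω : ℕ → Fin 2 | toLex ν ≤ toLex (shift^[n] ω)} ∧
      IsClosed {ω : ℕ → Fin 2 | toLex (shift^[n] ω) ≤ toLex ν} := by
  have hc : ∀ (k : ℕ) (S : Set (Fin 2)), IsClopen {ω : ℕ → Fin 2 | ω (n + k) ∈ S} := fun k S =>
    (isClopen_discrete S).preimage (continuous_apply (n + k))
  constructor
  · rw [← isOpen_compl_iff]
    have : {ω : ℕ → Fin 2 | toLex ν ≤ toLex (shift^[n] ω)}ᶜ =
        ⋃ k, (⋂ i ∈ Finset.range k, {ω | ω (n + i) ∈ ({ν i} : Set (Fin 2))}) ∩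
          {ω | ω (n + k) ∈ {d | d = 0 ∧ ν k = 1}} := by
      ext ω
      refine not_le.trans (toLex_lt_iff.trans ?_)
      simp [iterate_shift]
    rw [this]
    exact isOpen_iUnion fun k =>
      (isOpen_biInter_finset fun i _ => (hc i _).isOpen).inter (hc k _).isOpen
  · rw [← isOpen_compl_iff]
    have : {ω : ℕ → Fin 2 | toLex (shift^[n] ω) ≤ toLex ν}ᶜ =
        ⋃ k, (⋂ i ∈ Finset.range k, {ω | ω (n + i) ∈ ({ν i} : Set (Fin 2))}) ∩
          {ω | ω (n + k) ∈ {d | ν k = 0 ∧ d = 1}} := by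
      ext ω
      refine not_le.trans (toLex_lt_iff.trans ?_)
      simp [iterate_shift, @eq_comm _ (ν _) (ω _)]
    rw [this]
    exact isOpen_iUnion fun k =>
      (isOpen_biInter_finset fun i _ => (hc i _).isOpen).inter (hc k _).isOpen

theorem isSubshift_betaShift (h : (β, α) ∈ paramSet) : IsSubshift (betaShift β α) := by
  constructor
  · have : betaShift β α = ⋂ n, {ω | toLex (kneadZero β α) ≤ toLex (shift^[n] ω)} ∩
        {ω | toLex (shift^[n] ω) ≤ toLex (kneadOne β α)} := by
      ext ω
      simp [mem_betaShift_iff h]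
    rw [this]
    exact isClosed_iInter fun n =>
      (isClosed_setOf_toLex_le _ n).1.inter (isClosed_setOf_toLex_le _ n).2
  · intro ω hω
    rw [mem_betaShift_iff h] at hω ⊢
    intro n
    rw [← Function.iterate_succ_apply]
    exact hω (n + 1)

theorem betaShift_subset {β' α' : ℝ} (h : (β, α) ∈ paramSet) (h' : (β', α') ∈ paramSet)
    (h0 : toLex (kneadZero β α) ≤ toLex (kneadZero β' α'))
    (h1 : toLex (kneadOne β' α') ≤ toLex (kneadOne β α)) : betaShift β' α' ⊆ betaShift β α := by
  intro ω hω
  rw [mem_betaShift_iff h'] at hω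
  rw [mem_betaShift_iff h]
  exact fun n => ⟨h0.trans (hω n).1, (hω n).2.trans h1⟩

end Kneading

/-! ### Positivity of the total mass of the invariant density -/

section Mass

/-- A nondecreasing `1`-Lipschitz function on `[0, 1]` vanishing at `0`, that is, the distribution
function of a measure on `[0, 1]` with density at most `1`. -/
structure IsDistr (φ : ℝ → ℝ) : Prop where
  zero : φ 0 = 0
  mono : ∀ ⦃s t⦄, 0 ≤ s → s ≤ t → t ≤ 1 → φ s ≤ φ t
  lip : ∀ ⦃s t⦄, 0 ≤ s → s ≤ t → t ≤ 1 → φ t - φ s ≤ t - s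

/-- The pull-back of distribution functions: if `φ t` is the Lebesgue measure of `[0, t) ∩ A`, then
`pullback β α φ t` is the Lebesgue measure of `[0, t) ∩ T⁻¹ A`. -/
noncomputable def pullback (β α : ℝ) (φ : ℝ → ℝ) (t : ℝ) : ℝ :=
  β⁻¹ * if β * t + α ≤ 1 then φ (β * t + α) - φ α else φ (β * t + α - 1) - φ α + φ 1

variable {β α : ℝ}

theorem IsDistr.pullback (h : (β, α) ∈ paramSet) {φ : ℝ → ℝ} (hφ : IsDistr φ) :
    IsDistr (pullback β α φ) := by
  obtain ⟨⟨hb1, hb2⟩, ha0, ha1⟩ := h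
  simp only at hb1 hb2 ha0 ha1
  have hb : 0 < β := by linarith
  have key : ∀ s t, 0 ≤ s → s ≤ t → t ≤ 1 →
      0 ≤ IntermediateBeta.pullback β α φ t - IntermediateBeta.pullback β α φ s ∧
      IntermediateBeta.pullback β α φ t - IntermediateBeta.pullback β α φ s ≤ t - s := by
    intro s t hs hst ht
    have hbs : 0 ≤ β * s := by positivity
    have hbst : β * s ≤ β * t := by gcongr
    have hbt : β * t ≤ β := by nlinarith
    have aux : ∀ d, 0 ≤ d → d ≤ β * t - β * s → 0 ≤ β⁻¹ * d ∧ β⁻¹ * d ≤ t - s := by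
      intro d h0 h1
      refine ⟨by positivity, ?_⟩
      rw [inv_mul_le_iff₀ hb]
      linarith
    simp only [IntermediateBeta.pullback]
    rw [← mul_sub]
    refine aux _ ?_ ?_
    · split_ifs with h1 h2 h2
      · linarith [hφ.mono (s := β * s + α) (t := β * t + α) (by linarith) (by linarith) h1]
      · linarith
      · linarith [hφ.mono (s := 0) (t := β * t + α - 1) le_rfl (by linarith) (by linarith),
          hφ.mono (s := β * s + α) (t := 1) (by linarith) h2 le_rfl, hφ.zero]
      · linarith [hφ.mono (s := β * s + α - 1) (t := β * t + α - 1) (by linarith) (by linarith)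
          (by linarith)]
    · split_ifs with h1 h2 h2
      · linarith [hφ.lip (s := β * s + α) (t := β * t + α) (by linarith) (by linarith) h1]
      · linarith
      · linarith [hφ.lip (s := 0) (t := β * t + α - 1) le_rfl (by linarith) (by linarith),
          hφ.lip (s := β * s + α) (t := 1) (by linarith) h2 le_rfl, hφ.zero]
      · linarith [hφ.lip (s := β * s + α - 1) (t := β * t + α - 1) (by linarith) (by linarith)
          (by linarith)]
  refine ⟨?_, fun s t h1 h2 h3 => by linarith [(key s t h1 h2 h3).1],
    fun s t h1 h2 h3 => (key s t h1 h2 h3).2⟩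
  simp [IntermediateBeta.pullback, show α ≤ 1 by linarith]

theorem IsDistr.pullback_orbit {φ : ℝ → ℝ} (hφ : IsDistr φ)
    {ω : ℕ → Fin 2} {x : ℕ → ℝ} (hx : IsCoding β α ω x) (n : ℕ) :
    IntermediateBeta.pullback β α φ (x n) =
      β⁻¹ * (φ (x (n + 1)) - φ α + ((ω n : ℕ) : ℝ) * φ 1) := by
  have hs := hx.step n
  have hm := hx.mem (n + 1)
  rw [IntermediateBeta.pullback]
  rcases fin_two_cases (ω n) with e | e
  · rw [e] at hs ⊢
    simp at hs
    rw [if_pos (by linarith [hm.2]), hs]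
    simp
  · rw [e] at hs ⊢
    simp at hs
    split_ifs with h1
    · have : x (n + 1) = 0 := le_antisymm (by linarith) hm.1
      rw [this, hφ.zero, show β * x n + α = 1 by linarith]
      rw [show (((1 : Fin 2) : ℕ) : ℝ) = 1 by simp]
      ring
    · rw [hs]
      simp

theorem IsDistr.abs_sub_le {φ : ℝ → ℝ} (hφ : IsDistr φ) {s t : ℝ} (hs : s ∈ Set.Icc (0 : ℝ) 1)
    (ht : t ∈ Set.Icc (0 : ℝ) 1) : |φ s - φ t| ≤ φ 1 := by
  have h1 := hφ.mono le_rfl hs.1 hs.2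
  have h2 := hφ.mono le_rfl ht.1 ht.2
  have h3 := hφ.mono hs.1 hs.2 le_rfl
  have h4 := hφ.mono ht.1 ht.2 le_rfl
  rw [hφ.zero] at h1 h2
  exact abs_le.2 ⟨by linarith, by linarith⟩

theorem isDistr_hat {ε : ℝ} (h1 : ε ≤ 1) : IsDistr fun t => max 0 (t - (1 - ε)) := by
  refine ⟨max_eq_left (by linarith), fun s t _ hst _ => max_le_max le_rfl (by linarith),
    fun s t _ hst _ => ?_⟩
  rcases max_cases 0 (t - (1 - ε)) with h | h <;> rcases max_cases 0 (s - (1 - ε)) with h' | h' <;>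
    rw [h.1, h'.1] <;> linarith

theorem summable_geom_mul {c C : ℝ} (hc0 : 0 ≤ c) (hc1 : c < 1) {f : ℕ → ℝ}
    (hf : ∀ n, |f n| ≤ C) : Summable fun n => c ^ n * f n := by
  refine Summable.of_norm_bounded ((summable_geometric_of_lt_one hc0 hc1).mul_right C) fun n => ?_
  rw [norm_mul, Real.norm_of_nonneg (by positivity)]
  exact mul_le_mul_of_nonneg_left (hf n) (by positivity)

/-- The renewal equation, in terms of generating functions: with `m n` the Lebesgue measure of
`T⁻ⁿ J`, the gaps `y i - x i` between the orbits of `1` and of `0` satisfy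
`∑ (z / β) ^ i (|J ∩ [0, y i)| - |J ∩ [0, x i)|) =
(1 - z) (∑ z ^ n m n) (∑ (z / β) ^ i (y i - x i))`. -/
theorem renewal (h : (β, α) ∈ paramSet) {φ : ℝ → ℝ} (hφ : IsDistr φ) {z : ℝ} (hz0 : 0 ≤ z)
    (hz1 : z < 1) : ∃ μ : ℝ, 0 ≤ μ ∧ μ ≤ 1 ∧
      ∑' i, (z / β) ^ i * (φ (orbitOne β α i) - φ (orbitZero β α i)) =
        μ * ∑' i, (z / β) ^ i * (orbitOne β α i - orbitZero β α i) := by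
  have hβ := one_lt_of_mem h
  have hβ0 : 0 < β := by linarith
  have hx := isCoding_kneadZero h
  have hy := isCoding_kneadOne h
  set x := orbitZero β α
  set y := orbitOne β α
  set c := z / β with hc
  have hc0 : 0 ≤ c := by positivity
  have hc1 : c < 1 := (div_lt_one hβ0).2 (by linarith)
  let Φ : ℕ → ℝ → ℝ := fun n => (pullback β α)^[n] φ
  have hΦ : ∀ n, IsDistr (Φ n) := by
    intro n
    induction n with
    | zero => exact hφ
    | succ n ih =>
      simp only [Φ, Function.iterate_succ_apply']
      exact ih.pullback h
  have hΦ1 : ∀ n, 0 ≤ Φ n 1 ∧ Φ n 1 ≤ 1 := fun n => by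
    have h1 := (hΦ n).mono (s := 0) (t := 1) le_rfl zero_le_one le_rfl
    have h2 := (hΦ n).lip (s := 0) (t := 1) le_rfl zero_le_one le_rfl
    rw [(hΦ n).zero] at h1 h2
    exact ⟨h1, by linarith⟩
  have hw : ∀ i, |y i - x i| ≤ 1 := fun i =>
    abs_le.2 ⟨by linarith [(hy.mem i).1, (hx.mem i).2], by linarith [(hy.mem i).2, (hx.mem i).1]⟩
  have hD : ∀ n i, |Φ n (y i) - Φ n (x i)| ≤ 1 := fun n i =>
    ((hΦ n).abs_sub_le (hy.mem i) (hx.mem i)).trans (hΦ1 n).2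
  have hm : ∀ n, |Φ n 1| ≤ 1 := fun n => by rw [abs_of_nonneg (hΦ1 n).1]; exact (hΦ1 n).2
  let M := ∑' n, z ^ n * Φ n 1
  let A : ℕ → ℝ := fun i => ∑' n, z ^ n * (Φ n (y i) - Φ n (x i))
  have hsD := fun i => summable_geom_mul hz0 hz1 (hD · i)
  have hsM := summable_geom_mul hz0 hz1 hm
  have hrec : ∀ i, A i = (φ (y i) - φ (x i)) + c * A (i + 1) +
      (z * (y i - x i) - c * (y (i + 1) - x (i + 1))) * M := by
    intro i
    have h1 : ∀ n, z ^ (n + 1) * (Φ (n + 1) (y i) - Φ (n + 1) (x i)) =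
        c * (z ^ n * (Φ n (y (i + 1)) - Φ n (x (i + 1)))) +
          (z * (y i - x i) - c * (y (i + 1) - x (i + 1))) * (z ^ n * Φ n 1) := by
      intro n
      simp only [Φ, Function.iterate_succ_apply']
      rw [(hΦ n).pullback_orbit hy, (hΦ n).pullback_orbit hx, hy.step, hx.step, hc]
      field_simp
      ring
    simp only [A, M]
    rw [(hsD i).tsum_eq_zero_add, tsum_congr h1,
      ((hsD (i + 1)).mul_left c).tsum_add (hsM.mul_left _), tsum_mul_left, tsum_mul_left]
    simp [Φ, add_assoc]
  have hA0 : A 0 = M := by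
    refine tsum_congr fun n => ?_
    simp [x, y, (hΦ n).zero]
  have hAb : ∀ i, |A i| ≤ (1 - z)⁻¹ := by
    intro i
    rw [← tsum_geometric_of_lt_one hz0 hz1, ← Real.norm_eq_abs]
    refine tsum_of_norm_bounded (summable_geometric_of_lt_one hz0 hz1).hasSum fun n => ?_
    rw [norm_mul, Real.norm_of_nonneg (by positivity)]
    exact mul_le_of_le_one_right (by positivity) (hD n i)
  have hsA := summable_geom_mul hc0 hc1 hAb
  have hsw := summable_geom_mul hc0 hc1 hw
  have hsplit : ∀ i, c ^ i * (φ (y i) - φ (x i)) = c ^ i * A i - c ^ (i + 1) * A (i + 1) -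
      M * (z * (c ^ i * (y i - x i)) - c ^ (i + 1) * (y (i + 1) - x (i + 1))) := by
    intro i
    rw [hrec i, pow_succ]
    ring
  have hsA' := (summable_nat_add_iff 1).2 hsA
  have hsw' := (summable_nat_add_iff 1).2 hsw
  have hEA : ∑' i, c ^ i * (φ (y i) - φ (x i)) =
      M * (1 - z) * ∑' i, c ^ i * (y i - x i) := by
    rw [tsum_congr hsplit, (hsA.sub hsA').tsum_sub (((hsw.mul_left z).sub hsw').mul_left M),
      hsA.tsum_sub hsA', tsum_mul_left, (hsw.mul_left z).tsum_sub hsw', tsum_mul_left,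
      hsA.tsum_eq_zero_add]
    have := hsw.tsum_eq_zero_add
    have hw0 : y 0 - x 0 = 1 := by simp [x, y]
    rw [hw0] at this
    simp only [pow_zero, one_mul] at this ⊢
    rw [hA0]
    linear_combination -M * this
  refine ⟨M * (1 - z), mul_nonneg (tsum_nonneg fun n => mul_nonneg (by positivity) (hΦ1 n).1)
    (by linarith), ?_, hEA⟩
  have h2 := hAb 0
  rw [hA0] at h2
  have h3 : M ≤ (1 - z)⁻¹ := (le_abs_self _).trans h2
  calc M * (1 - z) ≤ (1 - z)⁻¹ * (1 - z) := by gcongr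
    _ = 1 := inv_mul_cancel₀ (by linarith)

theorem exists_tail_le {c : ℝ} (hc0 : 0 ≤ c) (hc1 : c < 1) {δ : ℝ} (hδ : 0 < δ) :
    ∃ K, 1 ≤ K ∧ c ^ K / (1 - c) ≤ δ := by
  obtain ⟨K, hK⟩ := exists_pow_lt_of_lt_one (mul_pos hδ (sub_pos.2 hc1)) hc1
  refine ⟨K + 1, by omega, ?_⟩
  rw [div_le_iff₀ (sub_pos.2 hc1)]
  exact (pow_le_pow_of_le_one hc0 hc1.le (by omega)).trans hK.le

theorem abs_tsum_tail_le {c C : ℝ} (hc0 : 0 ≤ c) (hc1 : c < 1) {f : ℕ → ℝ}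
    (hf : ∀ n, |f n| ≤ C) (K : ℕ) : |∑' i, c ^ (i + K) * f (i + K)| ≤ C * (c ^ K / (1 - c)) := by
  have hg : HasSum (fun i => C * (c ^ K * c ^ i)) (C * (c ^ K / (1 - c))) := by
    rw [div_eq_mul_inv]
    exact ((hasSum_geometric_of_lt_one hc0 hc1).mul_left _).mul_left _
  rw [← Real.norm_eq_abs]
  refine tsum_of_norm_bounded hg fun i => ?_
  rw [norm_mul, Real.norm_of_nonneg (by positivity), pow_add, mul_comm (c ^ i), mul_comm C]
  exact mul_le_mul_of_nonneg_left (hf _) (by positivity)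

/-- The function `∑ β ^ (-i) (1_[0, y i) - 1_[0, x i))` is an invariant density for the
transformation; its integral is positive. A test set `J = [1 - ε, 1)`, with `ε` small, meets only
late intervals `[0, x i)`, which keeps the left-hand side of `renewal` away from zero as
`z → 1`. -/
theorem tsum_orbitOne_sub_orbitZero_pos (h : (β, α) ∈ paramSet) :
    0 < ∑' i, (β⁻¹) ^ i * (orbitOne β α i - orbitZero β α i) := by
  have hβ := one_lt_of_mem h
  have hβ0 : 0 < β := by linarith
  have hr1 : β⁻¹ < 1 := inv_lt_one_of_one_lt₀ hβ
  have hr0 : 0 < β⁻¹ := by positivity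
  have hx := isCoding_kneadZero h
  have hy := isCoding_kneadOne h
  obtain ⟨K, hK1, hK⟩ := exists_tail_le hr0.le hr1 (δ := 1 / 2) (by norm_num)
  obtain ⟨ε, hε0, hε1, hεx⟩ : ∃ ε > 0, ε ≤ 1 ∧ ∀ i < K, orbitZero β α i ≤ 1 - ε := by
    have hne : (Finset.range K).Nonempty := Finset.nonempty_range_iff.2 (by omega)
    refine ⟨(Finset.range K).inf' hne fun i => 1 - orbitZero β α i, ?_, ?_, fun i hi => ?_⟩
    · rw [gt_iff_lt, Finset.lt_inf'_iff]
      exact fun i _ => by linarith [orbitZero_lt_one β α i]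
    · exact (Finset.inf'_le _ (Finset.mem_range.2 hK1)).trans (by simp)
    · have := Finset.inf'_le (fun i => 1 - orbitZero β α i) (Finset.mem_range.2 hi)
      linarith
  set φ : ℝ → ℝ := fun t => max 0 (t - (1 - ε)) with hφdef
  have hφ : IsDistr φ := isDistr_hat hε1
  have hφ1 : φ 1 = ε := by simp [hφdef, hε0.le]
  have hDb : ∀ i, |φ (orbitOne β α i) - φ (orbitZero β α i)| ≤ ε := fun i => by
    rw [← hφ1]
    exact hφ.abs_sub_le (hy.mem i) (hx.mem i)
  have hw : ∀ i, |orbitOne β α i - orbitZero β α i| ≤ 1 := fun i =>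
    abs_le.2 ⟨by linarith [(hy.mem i).1, (hx.mem i).2], by linarith [(hy.mem i).2, (hx.mem i).1]⟩
  have hlow : ∀ z : ℝ, 0 ≤ z → z < 1 →
      ε / 2 ≤ ∑' i, (z / β) ^ i * (orbitOne β α i - orbitZero β α i) := by
    intro z hz0 hz1
    have hc0 : 0 ≤ z / β := by positivity
    have hcr : z / β ≤ β⁻¹ := by rw [div_eq_mul_inv]; nlinarith
    have hc1 : z / β < 1 := by linarith
    have hE : ε / 2 ≤ ∑' i, (z / β) ^ i * (φ (orbitOne β α i) - φ (orbitZero β α i)) := by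
      rw [← (summable_geom_mul hc0 hc1 hDb).sum_add_tsum_nat_add K]
      have h1 : ε ≤ ∑ i ∈ Finset.range K,
          (z / β) ^ i * (φ (orbitOne β α i) - φ (orbitZero β α i)) := by
        have h2 : ∀ i ∈ Finset.range K,
            0 ≤ (z / β) ^ i * (φ (orbitOne β α i) - φ (orbitZero β α i)) := by
          intro i hi
          have : φ (orbitZero β α i) = 0 :=
            max_eq_left (by linarith [hεx i (Finset.mem_range.1 hi)])
          rw [this, sub_zero]
          exact mul_nonneg (by positivity) (le_max_left _ _)
        refine le_trans (le_of_eq ?_) (Finset.single_le_sum h2 (Finset.mem_range.2 hK1))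
        simp [hφ1, hφ.zero]
      have h3 := (abs_le.1 (abs_tsum_tail_le hc0 hc1 hDb K)).1
      have h4 : (z / β) ^ K / (1 - z / β) ≤ 1 / 2 :=
        (div_le_div₀ (by positivity) (by gcongr) (by linarith) (by linarith)).trans hK
      have h5 : ε * ((z / β) ^ K / (1 - z / β)) ≤ ε * (1 / 2) := by gcongr
      linarith
    obtain ⟨μ, hμ0, hμ1, hμ⟩ := renewal h hφ hz0 hz1
    rw [hμ] at hE
    set F := ∑' i, (z / β) ^ i * (orbitOne β α i - orbitZero β α i)
    rcases le_total F 0 with hF | hF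
    · linarith [mul_nonpos_of_nonneg_of_nonpos hμ0 hF]
    · exact hE.trans (mul_le_of_le_one_left hF hμ1)
  have hlim : Tendsto (fun z : ℝ => ∑' i, (z / β) ^ i * (orbitOne β α i - orbitZero β α i))
      (𝓝[<] 1) (𝓝 (∑' i, (β⁻¹) ^ i * (orbitOne β α i - orbitZero β α i))) := by
    refine tendsto_tsum_of_dominated_convergence (summable_geometric_of_lt_one hr0.le hr1)
      (fun i => ?_) ?_
    · have : Tendsto (fun z : ℝ => (z / β) ^ i * (orbitOne β α i - orbitZero β α i)) (𝓝 1)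
          (𝓝 ((1 / β) ^ i * (orbitOne β α i - orbitZero β α i))) :=
        ((tendsto_id.div_const β).pow i).mul_const _
      rw [one_div] at this
      exact this.mono_left nhdsWithin_le_nhds
    · filter_upwards [Ioo_mem_nhdsLT (show (0 : ℝ) < 1 by norm_num)] with z hz i
      have hz0 : 0 ≤ z / β := div_nonneg hz.1.le hβ0.le
      rw [norm_mul, Real.norm_of_nonneg (by positivity)]
      calc (z / β) ^ i * ‖orbitOne β α i - orbitZero β α i‖ ≤ (z / β) ^ i * 1 :=
            mul_le_mul_of_nonneg_left (hw i) (by positivity)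
        _ ≤ β⁻¹ ^ i := by
            rw [mul_one]
            have : z / β ≤ β⁻¹ := by rw [div_eq_mul_inv]; nlinarith [hz.2]
            gcongr
  have hge : ε / 2 ≤ ∑' i, (β⁻¹) ^ i * (orbitOne β α i - orbitZero β α i) := by
    refine ge_of_tendsto hlim ?_
    filter_upwards [Ioo_mem_nhdsLT (show (0 : ℝ) < 1 by norm_num)] with z hz
    exact hlow z hz.1.le hz.2
  linarith

end Mass

/-! ### Periodic kneading sequences and finite type -/

theorem mem_language_iff {m : ℕ} {Ω : Set (ℕ → Fin m)} {w : List (Fin m)} :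
    w ∈ language Ω ↔ ∃ ξ ∈ Ω, ∀ i (hi : i < w.length), w[i] = ξ i := by
  constructor
  · rintro ⟨n, ξ, hξ, rfl⟩
    exact ⟨ξ, hξ, fun i hi => by simp [prefixWord]⟩
  · rintro ⟨ξ, hξ, hw⟩
    refine ⟨w.length, ξ, hξ, List.ext_getElem (by simp [prefixWord]) fun i h1 h2 => ?_⟩
    rw [hw i h2]
    simp [prefixWord]

theorem iterate_shift_mem {β α : ℝ} (h : (β, α) ∈ paramSet) {ω : ℕ → Fin 2}
    (hω : ω ∈ betaShift β α) (n : ℕ) : shift^[n] ω ∈ betaShift β α := by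
  induction n with
  | zero => exact hω
  | succ n ih =>
    rw [Function.iterate_succ_apply']
    exact (isSubshift_betaShift h).2 _ ih

/-- Exceeding a sequence of period `L` can be tested on the first `L` letters and, if these agree,
on the shifted word. -/
theorem le_of_prefix_of_shift {u ξ ω : ℕ → Fin 2} {L : ℕ} (hu : Function.Periodic u L)
    (hξ : toLex u ≤ toLex ξ) (hag : ∀ i < L, ω i = ξ i) (hω : toLex u ≤ toLex (shift^[L] ω)) :
    toLex u ≤ toLex ω := by
  by_contra hc
  obtain ⟨k, hk, hk0, hk1⟩ := toLex_lt_iff.1 (not_le.1 hc)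
  rcases lt_or_ge k L with hkL | hkL
  · refine absurd hξ (not_le.2 (toLex_lt_iff.2 ⟨k, fun i hi => ?_, ?_, hk1⟩))
    · rw [← hag i (by omega), hk i hi]
    · rw [← hag k hkL, hk0]
  · refine absurd hω (not_le.2 (toLex_lt_iff.2 ⟨k - L, fun i hi => ?_, ?_, ?_⟩))
    · rw [iterate_shift, hk _ (by omega), add_comm, hu]
    · rw [iterate_shift, Nat.add_sub_cancel' hkL, hk0]
    · rw [← hu, Nat.sub_add_cancel hkL, hk1]

theorem periodic_flip {ω : ℕ → Fin 2} {L : ℕ} :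
    Function.Periodic (flip ω) L ↔ Function.Periodic ω L := by
  constructor
  · intro h i
    have := h i
    simp only [flip] at this
    omega
  · intro h i
    simp only [flip, h i]

theorem ge_of_prefix_of_shift {v ξ ω : ℕ → Fin 2} {L : ℕ} (hv : Function.Periodic v L)
    (hξ : toLex ξ ≤ toLex v) (hag : ∀ i < L, ω i = ξ i) (hω : toLex (shift^[L] ω) ≤ toLex v) :
    toLex ω ≤ toLex v := by
  have := le_of_prefix_of_shift (periodic_flip.2 hv) (toLex_le_flip hξ) (ω := flip ω)
    (fun i hi => by simp only [flip, hag i hi])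
    (by rw [iterate_shift_flip]; exact toLex_le_flip hω)
  have := toLex_le_flip this
  rwa [flip_flip, flip_flip] at this

/-- The shift is of finite type as soon as both kneading sequences are periodic. -/
theorem isSubshiftOfFiniteType_of_periodic {β α : ℝ} (h : (β, α) ∈ paramSet) {L L' : ℕ}
    (hL : 0 < L) (hL' : 0 < L') (h0 : Function.Periodic (kneadZero β α) L)
    (h1 : Function.Periodic (kneadOne β α) L') : IsSubshiftOfFiniteType (betaShift β α) := by
  refine ⟨isSubshift_betaShift h, max L L', le_max_of_le_left hL, ?_⟩
  intro u hu v hv hlen hv1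
  set s := u.length - max L L' with hs
  constructor
  · intro hw
    obtain ⟨ξ, hξ, hξu⟩ := mem_language_iff.1 hu
    obtain ⟨η, hη, hηw⟩ := mem_language_iff.1 hw
    have hξη : ∀ i, s ≤ i → i < u.length → ξ i = η (i - s) := by
      intro i hi1 hi2
      rw [← hηw (i - s) (by simp; omega), ← hξu i hi2,
        List.getElem_append_left (by simp; omega), List.getElem_drop]
      congr 1
      omega
    let ω : ℕ → Fin 2 := fun i => if i < s then ξ i else η (i - s)
    have hωξ : ∀ i < u.length, ω i = ξ i := by
      intro i hi
      simp only [ω]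
      split_ifs with hc
      · rfl
      · exact (hξη i (by omega) hi).symm
    rw [mem_betaShift_iff h] at hξ hη
    have hωη : ∀ j, shift^[s + j] ω = shift^[j] η := by
      intro j
      funext i
      simp only [iterate_shift, ω]
      rw [if_neg (by omega)]
      congr 1
      omega
    -- Downward induction on the position: from position `s` on, the shifts of `ω` are those of `η`.
    have key : ∀ j n, s ≤ n + j → toLex (kneadZero β α) ≤ toLex (shift^[n] ω) ∧
        toLex (shift^[n] ω) ≤ toLex (kneadOne β α) := by
      intro j
      induction j with
      | zero =>
        intro n hn
        obtain ⟨d, rfl⟩ := Nat.exists_eq_add_of_le (show s ≤ n by omega)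
        rw [hωη]
        exact hη d
      | succ j ih =>
        intro n hn
        rcases lt_or_ge n s with hns | hns
        · constructor
          · refine le_of_prefix_of_shift h0 (hξ n).1 (fun i hi => ?_) ?_
            · rw [iterate_shift, iterate_shift, hωξ]
              have := le_max_left L L'
              omega
            · rw [← Function.iterate_add_apply]
              exact (ih (L + n) (by omega)).1
          · refine ge_of_prefix_of_shift h1 (hξ n).2 (fun i hi => ?_) ?_
            · rw [iterate_shift, iterate_shift, hωξ]
              have := le_max_right L L'
              omega
            · rw [← Function.iterate_add_apply]
              exact (ih (L' + n) (by omega)).2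
        · obtain ⟨d, rfl⟩ := Nat.exists_eq_add_of_le hns
          rw [hωη]
          exact hη d
    refine mem_language_iff.2 ⟨ω, (mem_betaShift_iff h).2 fun n => key s n (by omega), ?_⟩
    intro i hi
    rw [List.length_append] at hi
    rcases lt_or_ge i u.length with hiu | hiu
    · rw [List.getElem_append_left hiu, hξu i hiu, hωξ i hiu]
    · simp only [ω]
      rw [if_neg (by omega), ← hηw (i - s) (by simp; omega), List.getElem_append_right hiu,
        List.getElem_append_right (by simp; omega)]
      congr 1
      simp
      omega
  · intro hw
    obtain ⟨ξ, hξ, hξw⟩ := mem_language_iff.1 hw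
    refine mem_language_iff.2 ⟨shift^[s] ξ, iterate_shift_mem h hξ s, fun i hi => ?_⟩
    have hi' : i + s < (u ++ v).length := by
      simp only [List.length_append, List.length_drop] at hi ⊢
      omega
    have : (u.drop s ++ v)[i] = (u ++ v)[s + i]'(by omega) := by
      rcases lt_or_ge i (u.drop s).length with hiu | hiu
      · rw [List.getElem_append_left hiu, List.getElem_drop, List.getElem_append_left]
      · rw [List.getElem_append_right hiu, List.getElem_append_right]
        · congr 1
          simp only [List.length_drop] at hiu ⊢
          omega
        · simp only [List.length_drop] at hiu
          omega
    rw [this, hξw _ (by omega), iterate_shift]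

/-! ### Continuity in the parameters -/

/-- The first `k` letters of the expansion of a fixed point are locally constant in the parameters
as long as the orbit avoids the critical point. -/
theorem eventually_upperExpansion_eq {β α : ℝ} (h : (β, α) ∈ paramSet) {x : ℝ}
    (hx : x ∈ Set.Ico (0 : ℝ) 1) {k : ℕ} (hne : ∀ i < k, β * (upperMap β α)^[i] x + α ≠ 1) :
    ∀ᶠ q in 𝓝[paramSet] (β, α), ∀ i < k,
      upperExpansion q.1 q.2 x i = upperExpansion β α x i := by
  have hq1 : Tendsto (fun q : ℝ × ℝ => q.1) (𝓝[paramSet] (β, α)) (𝓝 β) :=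
    (continuous_fst.tendsto (β, α)).mono_left nhdsWithin_le_nhds
  have hq2 : Tendsto (fun q : ℝ × ℝ => q.2) (𝓝[paramSet] (β, α)) (𝓝 α) :=
    (continuous_snd.tendsto (β, α)).mono_left nhdsWithin_le_nhds
  have hΔ : ∀ᶠ q in 𝓝[paramSet] (β, α), q ∈ paramSet := self_mem_nhdsWithin
  suffices H : ∀ n ≤ k, Tendsto (fun q : ℝ × ℝ => (upperMap q.1 q.2)^[n] x)
      (𝓝[paramSet] (β, α)) (𝓝 ((upperMap β α)^[n] x)) ∧
      ∀ᶠ q in 𝓝[paramSet] (β, α), ∀ i < n,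
        upperExpansion q.1 q.2 x i = upperExpansion β α x i from (H k le_rfl).2
  intro n
  induction n with
  | zero => exact fun _ => ⟨tendsto_const_nhds, Eventually.of_forall fun q i hi => by omega⟩
  | succ n ih =>
    intro hn
    obtain ⟨ih1, ih2⟩ := ih (by omega)
    have hlin : Tendsto (fun q : ℝ × ℝ => q.1 * (upperMap q.1 q.2)^[n] x + q.2)
        (𝓝[paramSet] (β, α)) (𝓝 (β * (upperMap β α)^[n] x + α)) := (hq1.mul ih1).add hq2
    have hd : ∀ᶠ q in 𝓝[paramSet] (β, α),
        upperExpansion q.1 q.2 x n = upperExpansion β α x n := by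
      have hz := upperExpansion_eq_zero_iff (α := α) (one_lt_of_mem h) x n
      rcases (hne n (by omega)).lt_or_gt with hlt | hgt
      · filter_upwards [hlin.eventually_lt_const hlt, hΔ] with q hq hqΔ
        rw [hz.2 hlt]
        exact (upperExpansion_eq_zero_iff (one_lt_of_mem hqΔ) x n).2 hq
      · filter_upwards [hlin.eventually_const_lt hgt, hΔ] with q hq hqΔ
        have h1 : upperExpansion β α x n ≠ 0 := fun hc => by linarith [hz.1 hc]
        have h2 : upperExpansion q.1 q.2 x n ≠ 0 := fun hc => by
          linarith [(upperExpansion_eq_zero_iff (one_lt_of_mem hqΔ) x n).1 hc]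
        omega
    refine ⟨?_, ?_⟩
    · have hstep := (isCoding_upper h hx).step n
      rw [hstep]
      refine (hlin.sub_const _).congr' ?_
      filter_upwards [hd, hΔ] with q hq hqΔ
      have := (isCoding_upper hqΔ hx).step n
      rw [this, hq]
    · filter_upwards [hd, ih2] with q h1 h2 i hi
      rcases (Nat.lt_succ_iff_lt_or_eq.1 hi) with hi | rfl
      · exact h2 i hi
      · exact h1

/-- Slightly to the right of `x` the expansion begins like that of `x`, and the orbit has moved off
the critical point. -/
theorem eventually_right_of_upper {β α : ℝ} (h : (β, α) ∈ paramSet) {x : ℝ}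
    (hx : x ∈ Set.Ico (0 : ℝ) 1) (k : ℕ) :
    ∀ᶠ y in 𝓝[>] x, ∀ i < k, upperExpansion β α y i = upperExpansion β α x i ∧
      β * (upperMap β α)^[i] y + α ≠ 1 := by
  have hβ := one_lt_of_mem h
  have hI : ∀ᶠ y in 𝓝[>] x, y ∈ Set.Ioo x 1 := Ioo_mem_nhdsGT hx.2
  induction k with
  | zero => exact Eventually.of_forall fun y i hi => by omega
  | succ k ih =>
    have hz := upperExpansion_eq_zero_iff (α := α) hβ x k
    have hlim : Tendsto (fun y => β * ((upperMap β α)^[k] x + β ^ k * (y - x)) + α) (𝓝[>] x)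
        (𝓝 (β * ((upperMap β α)^[k] x + β ^ k * (x - x)) + α)) := by
      refine Tendsto.mono_left ?_ nhdsWithin_le_nhds
      exact Continuous.tendsto (by fun_prop) x
    rw [sub_self, mul_zero, add_zero] at hlim
    have hk : ∀ᶠ y in 𝓝[>] x, (∀ i < k, upperExpansion β α y i = upperExpansion β α x i) →
        upperExpansion β α y k = upperExpansion β α x k ∧
          β * (upperMap β α)^[k] y + α ≠ 1 := by
      have horb : ∀ y ∈ Set.Ioo x 1, (∀ i < k, upperExpansion β α y i = upperExpansion β α x i) →
          (upperMap β α)^[k] y = (upperMap β α)^[k] x + β ^ k * (y - x) := by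
        intro y hy hag
        have := (isCoding_upper h hx).sub_eq (isCoding_upper h ⟨hx.1.trans hy.1.le, hy.2⟩)
          (n := k) fun i hi => (hag i hi).symm
        simp only [Function.iterate_zero, id] at this
        linarith
      rcases lt_or_ge (β * (upperMap β α)^[k] x + α) 1 with hlt | hge
      · filter_upwards [hlim.eventually_lt_const hlt, hI] with y hy1 hy hag
        rw [← horb y hy hag] at hy1
        rw [hz.2 hlt]
        exact ⟨(upperExpansion_eq_zero_iff hβ y k).2 hy1, hy1.ne⟩
      · filter_upwards [hI] with y hy hag
        have h2 : 0 < β ^ k * (y - x) := mul_pos (by positivity) (by linarith [hy.1])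
        have h3 : 1 < β * (upperMap β α)^[k] y + α := by
          rw [horb y hy hag]
          nlinarith
        have h4 : upperExpansion β α x k ≠ 0 := fun hc => by linarith [hz.1 hc]
        have h5 : upperExpansion β α y k ≠ 0 := fun hc => by
          linarith [(upperExpansion_eq_zero_iff hβ y k).1 hc]
        exact ⟨by omega, h3.ne'⟩
    filter_upwards [ih, hk] with y h1 h2 i hi
    rcases (Nat.lt_succ_iff_lt_or_eq.1 hi) with hi | rfl
    · exact h1 i hi
    · exact h2 fun j hj => (h1 j hj).1

/-- A prefix of a word of the shift occurs in the shifts of all nearby parameters: it is a prefix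
of the expansion of some point whose orbit avoids the critical point for as long. -/
theorem eventually_exists_prefix {β α : ℝ} (h : (β, α) ∈ paramSet) {ω : ℕ → Fin 2}
    (hω : ω ∈ betaShift β α) (k : ℕ) :
    ∀ᶠ q in 𝓝[paramSet] (β, α), ∃ ν ∈ betaShift q.1 q.2, ∀ i < k, ν i = ω i := by
  have hup : ∀ x ∈ Set.Ico (0 : ℝ) 1, ∀ᶠ q in 𝓝[paramSet] (β, α),
      ∃ ν ∈ betaShift q.1 q.2, ∀ i < k, ν i = upperExpansion β α x i := by
    intro x hx
    obtain ⟨y, hy, hyx⟩ := ((eventually_right_of_upper h hx k).and (Ioo_mem_nhdsGT hx.2)).exists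
    have hy' : y ∈ Set.Ico (0 : ℝ) 1 := ⟨hx.1.trans hyx.1.le, hyx.2⟩
    filter_upwards [eventually_upperExpansion_eq h hy' fun i hi => (hy i hi).2] with q hq
    exact ⟨_, Or.inl ⟨y, hy', rfl⟩, fun i hi => (hq i hi).trans (hy i hi).1⟩
  rcases hω with ⟨x, hx, rfl⟩ | ⟨x, hx, rfl⟩
  · exact hup x hx
  · have h1 : ∀ᶠ y in 𝓝[<] x, ∀ i < k, upperExpansion β α y i = lowerExpansion β α x i := by
      have h2 := tendsto_pi_nhds.1 (tendsto_upperExpansion h hx)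
      simp only [nhds_discrete, tendsto_pure] at h2
      exact (Set.finite_lt_nat k).eventually_all.2 fun i _ => h2 i
    obtain ⟨y, hy, hyx⟩ := (h1.and (Ioo_mem_nhdsLT hx.1)).exists
    filter_upwards [hup y ⟨hyx.1.le, hyx.2.trans_le hx.2⟩] with q ⟨ν, hν, hνy⟩
    exact ⟨ν, hν, fun i hi => (hνy i hi).trans (hy i hi)⟩

/-- There are finitely many prefixes of length `k`, so their persistence is uniform. -/
theorem eventually_forall_exists_prefix {β α : ℝ} (h : (β, α) ∈ paramSet) (k : ℕ) :
    ∀ᶠ q in 𝓝[paramSet] (β, α), ∀ ω ∈ betaShift β α,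
      ∃ ν ∈ betaShift q.1 q.2, ∀ i < k, ν i = ω i := by
  have : ∀ w : Fin k → Fin 2, ∀ᶠ q in 𝓝[paramSet] (β, α),
      (∃ ω ∈ betaShift β α, ∀ i : Fin k, ω i = w i) →
        ∃ ν ∈ betaShift q.1 q.2, ∀ i : Fin k, ν i = w i := by
    intro w
    by_cases hw : ∃ ω ∈ betaShift β α, ∀ i : Fin k, ω i = w i
    · obtain ⟨ω, hω, hωw⟩ := hw
      filter_upwards [eventually_exists_prefix h hω k] with q ⟨ν, hν, hνω⟩ _
      exact ⟨ν, hν, fun i => (hνω i i.2).trans (hωw i)⟩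
    · exact Eventually.of_forall fun q hc => absurd hc hw
  filter_upwards [eventually_all.2 this] with q hq ω hω
  obtain ⟨ν, hν, hνω⟩ := hq (fun i => ω i) ⟨ω, hω, fun i => rfl⟩
  exact ⟨ν, hν, fun i hi => hνω ⟨i, hi⟩⟩

theorem wordHausdorffDist_le {A B : Set (ℕ → Fin 2)} (hBA : B ⊆ A) {k : ℕ}
    (hk : ∀ ω ∈ A, ∃ ν ∈ B, ∀ i < k, ν i = ω i) : wordHausdorffDist A B ≤ (1 / 2) ^ k := by
  let _ := wordMetric 2
  refine Metric.hausdorffDist_le_of_mem_dist (by positivity) (fun ω hω => ?_) fun ω hω => ?_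
  · obtain ⟨ν, hν, hag⟩ := hk ω hω
    refine ⟨ν, hν, PiNat.mem_cylinder_iff_dist_le.1 ?_⟩
    exact fun i hi => (hag i hi).symm
  · refine ⟨ω, hBA hω, ?_⟩
    rw [dist_self]
    positivity

theorem tendsto_wordHausdorffDist {β α : ℝ} (h : (β, α) ∈ paramSet) {s : ℕ → ℝ × ℝ}
    (hs : Tendsto s atTop (𝓝[paramSet] (β, α)))
    (hsub : ∀ n, betaShift (s n).1 (s n).2 ⊆ betaShift β α) :
    Tendsto (fun n => wordHausdorffDist (betaShift β α) (betaShift (s n).1 (s n).2)) atTop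
      (𝓝 0) := by
  rw [Metric.tendsto_nhds]
  intro ε hε
  obtain ⟨k, hk⟩ := exists_pow_lt_of_lt_one hε (show (1 / 2 : ℝ) < 1 by norm_num)
  filter_upwards [hs.eventually (eventually_forall_exists_prefix h k)] with n hn
  have h0 : 0 ≤ wordHausdorffDist (betaShift β α) (betaShift (s n).1 (s n).2) :=
    @Metric.hausdorffDist_nonneg _ (wordMetric 2).toPseudoMetricSpace _ _
  rw [Real.dist_eq, sub_zero, abs_of_nonneg h0]
  exact (wordHausdorffDist_le (hsub n) hn).trans_lt hk

/-! ### Perturbation of the parameters -/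

/-- The effect of a change of the parameters on an orbit, as long as its coding is unchanged. -/
theorem IsCoding.perturb {β α β' α' : ℝ} {ω ν : ℕ → Fin 2} {x y : ℕ → ℝ} (hβ' : β' ≠ 0)
    (hx : IsCoding β α ω x) (hy : IsCoding β' α' ν y) (h0 : x 0 = y 0) {n : ℕ}
    (hn : ∀ i < n, ω i = ν i) :
    β' * y n + α' - (β * x n + α) =
      β' ^ n * ∑ i ∈ Finset.range (n + 1), β'⁻¹ ^ i * ((β' - β) * x i + (α' - α)) := by
  induction n with
  | zero => simp [h0]; ring
  | succ n ih =>
    have ih := ih fun i hi => hn i (by omega)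
    have h1 : y (n + 1) - x (n + 1) = β' * y n + α' - (β * x n + α) := by
      rw [hx.step, hy.step, hn n (by omega)]
      ring
    rw [ih] at h1
    have h2 : β' ^ (n + 1) * β'⁻¹ ^ (n + 1) = 1 := by
      rw [← mul_pow, mul_inv_cancel₀ hβ', one_pow]
    rw [Finset.sum_range_succ]
    linear_combination β' * h1 - ((β' - β) * x (n + 1) + (α' - α)) * h2

/-- Admissible data for the path of parameters `t ↦ (β - t, α + A t * t)`, `0 ≤ t ≤ r`. -/
structure IsPath (β : ℝ) (A : ℝ → ℝ) (r : ℝ) : Prop where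
  pos : 0 < r
  lt : r < β - 1
  cont : ContinuousOn A (Set.Icc 0 r)
  mem : ∀ t ∈ Set.Icc 0 r, A t ∈ Set.Icc (0 : ℝ) 1

section Path

variable {β α r : ℝ} {A : ℝ → ℝ}

theorem IsPath.mem_paramSet (hA : IsPath β A r) (h : (β, α) ∈ paramSet) {t : ℝ}
    (ht : t ∈ Set.Icc 0 r) : (β - t, α + A t * t) ∈ paramSet := by
  obtain ⟨⟨hb1, hb2⟩, ha0, ha1⟩ := h
  simp only at hb1 hb2 ha0 ha1
  have h1 : 0 ≤ A t * t := mul_nonneg (hA.mem t ht).1 ht.1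
  have h2 : A t * t ≤ t := mul_le_of_le_one_left ht.1 (hA.mem t ht).2
  have h3 := hA.lt
  exact ⟨⟨by linarith [ht.2], by linarith [ht.1]⟩, by simp only; linarith, by simp only; linarith⟩

theorem IsPath.reflect (hA : IsPath β A r) : IsPath β (fun t => 1 - A t) r :=
  ⟨hA.pos, hA.lt, continuousOn_const.sub hA.cont,
    fun t ht => ⟨by linarith [(hA.mem t ht).2], by linarith [(hA.mem t ht).1]⟩⟩

theorem IsPath.eventually_mem (hA : IsPath β A r) : ∀ᶠ t in 𝓝[>] (0 : ℝ), t ∈ Set.Ioc 0 r :=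
  Ioc_mem_nhdsGT hA.pos

theorem IsPath.tendsto_dir (hA : IsPath β A r) : Tendsto A (𝓝[>] 0) (𝓝 (A 0)) := by
  have h1 : Tendsto A (𝓝[Set.Icc 0 r] 0) (𝓝 (A 0)) := hA.cont 0 ⟨le_rfl, hA.pos.le⟩
  refine h1.mono_left (nhdsWithin_le_of_mem ?_)
  filter_upwards [hA.eventually_mem] with t ht
  exact ⟨ht.1.le, ht.2⟩

theorem IsPath.tendsto (hA : IsPath β A r) (h : (β, α) ∈ paramSet) :
    Tendsto (fun t => (β - t, α + A t * t)) (𝓝[>] 0) (𝓝[paramSet] (β, α)) := by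
  refine tendsto_nhdsWithin_iff.2 ⟨?_, ?_⟩
  · have hid : Tendsto (fun t : ℝ => t) (𝓝[>] 0) (𝓝 0) := tendsto_id.mono_left nhdsWithin_le_nhds
    have h1 := (hid.const_sub β).prodMk_nhds ((hA.tendsto_dir.mul hid).const_add α)
    simpa using h1
  · filter_upwards [hA.eventually_mem] with t ht
    exact hA.mem_paramSet h ⟨ht.1.le, ht.2⟩

/-- If `∑ β ^ (-i) (A 0 - x i) > 0`, then the late partial sums are bounded away from zero,
uniformly along the path. -/
theorem IsPath.eventually_le_sum (hA : IsPath β A r) (hβ : 1 < β) {x : ℕ → ℝ}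
    (hx : ∀ i, x i ∈ Set.Icc (0 : ℝ) 1) (hpos : 0 < ∑' i, β⁻¹ ^ i * (A 0 - x i)) :
    ∃ N : ℕ, ∃ c > 0, ∀ᶠ t in 𝓝[>] (0 : ℝ), ∀ n ≥ N,
      c ≤ ∑ i ∈ Finset.range n, (β - t)⁻¹ ^ i * (A t - x i) := by
  set S := ∑' i, β⁻¹ ^ i * (A 0 - x i) with hS
  have hβ0 : 0 < β := by linarith
  set b := (1 + β) / 2 with hb
  have hb1 : 1 < b := by linarith
  have hc1 : b⁻¹ < 1 := inv_lt_one_of_one_lt₀ hb1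
  have hc0 : 0 ≤ b⁻¹ := by positivity
  have hβ1 : β⁻¹ < 1 := inv_lt_one_of_one_lt₀ hβ
  have hβb : β⁻¹ ≤ b⁻¹ := inv_anti₀ (by linarith) (by linarith)
  obtain ⟨N, -, hN⟩ := exists_tail_le hc0 hc1 (δ := S / 4) (by linarith)
  have hbound : ∀ t ∈ Set.Icc 0 r, ∀ i, |A t - x i| ≤ 1 := fun t ht i =>
    abs_le.2 ⟨by linarith [(hA.mem t ht).1, (hx i).2], by linarith [(hA.mem t ht).2, (hx i).1]⟩
  have hb0 := hbound 0 ⟨le_rfl, hA.pos.le⟩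
  have hpart : S / 2 < ∑ i ∈ Finset.range N, β⁻¹ ^ i * (A 0 - x i) := by
    have h1 := (summable_geom_mul (by positivity) hβ1 hb0).sum_add_tsum_nat_add N
    have h2 := (abs_le.1 (abs_tsum_tail_le (by positivity) hβ1 hb0 N)).2
    have h3 : β⁻¹ ^ N / (1 - β⁻¹) ≤ b⁻¹ ^ N / (1 - b⁻¹) :=
      div_le_div₀ (by positivity) (by gcongr) (by linarith) (by linarith)
    rw [← hS] at h1
    linarith
  have hlim : Tendsto (fun t => ∑ i ∈ Finset.range N, (β - t)⁻¹ ^ i * (A t - x i)) (𝓝[>] 0)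
      (𝓝 (∑ i ∈ Finset.range N, β⁻¹ ^ i * (A 0 - x i))) := by
    refine tendsto_finsetSum _ fun i _ => ?_
    have hid : Tendsto (fun t : ℝ => β - t) (𝓝[>] 0) (𝓝 β) := by
      have : Tendsto (fun t : ℝ => β - t) (𝓝[>] 0) (𝓝 (β - 0)) :=
        (tendsto_id.mono_left nhdsWithin_le_nhds).const_sub β
      rwa [sub_zero] at this
    exact ((hid.inv₀ hβ0.ne').pow i).mul (hA.tendsto_dir.sub_const _)
  refine ⟨N, S / 4, by linarith, ?_⟩
  have hsmall : ∀ᶠ t in 𝓝[>] (0 : ℝ), t ∈ Set.Ioo 0 ((β - 1) / 2) :=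
    Ioo_mem_nhdsGT (by linarith)
  filter_upwards [hlim.eventually_const_lt hpart, hA.eventually_mem, hsmall] with t ht htr hts n hn
  rw [← Finset.sum_range_add_sum_Ico _ hn]
  have hbt : b ≤ β - t := by linarith [hts.2]
  have h1 : |∑ i ∈ Finset.Ico N n, (β - t)⁻¹ ^ i * (A t - x i)| ≤ S / 4 := by
    refine (Finset.abs_sum_le_sum_abs _ _).trans (le_trans ?_ ((geom_sum_Ico_le_of_lt_one
      (m := N) (n := n) hc0 hc1).trans hN))
    refine Finset.sum_le_sum fun i _ => ?_
    have h2 : (β - t)⁻¹ ≤ b⁻¹ := inv_anti₀ (by linarith) hbt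
    have h3 : 0 ≤ (β - t)⁻¹ := inv_nonneg.2 (by linarith)
    rw [abs_mul, abs_of_nonneg (by positivity)]
    calc (β - t)⁻¹ ^ i * |A t - x i| ≤ b⁻¹ ^ i * 1 := by
          gcongr
          exact hbound t ⟨htr.1.le, htr.2⟩ i
      _ = b⁻¹ ^ i := mul_one _
  linarith [(abs_le.1 h1).1]

theorem periodic_of_orbitZero_eq_zero (h : (β, α) ∈ paramSet) {L : ℕ}
    (hL : orbitZero β α L = 0) : Function.Periodic (kneadZero β α) L := by
  have h1 := ((isCoding_kneadZero h).shift_iterate L).eq_upper h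
    (fun n => orbitZero_lt_one β α _)
  rw [add_zero, hL] at h1
  intro i
  rw [add_comm, ← iterate_shift (kneadZero β α)]
  exact congrFun h1.1 i

theorem orbitZero_periodic (h : (β, α) ∈ paramSet) {L : ℕ}
    (hL : Function.Periodic (kneadZero β α) L) : Function.Periodic (orbitZero β α) L := by
  have h1 := (isCoding_kneadZero h).shift_iterate L
  have h2 : shift^[L] (kneadZero β α) = kneadZero β α := by
    funext i
    rw [iterate_shift, add_comm, hL]
  rw [h2] at h1
  intro i
  rw [add_comm]
  exact congrFun (h1.orbit_unique (one_lt_of_mem h) (isCoding_kneadZero h)) i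

theorem orbitZero_succ_eq_zero (h : (β, α) ∈ paramSet) {n : ℕ}
    (hn : β * orbitZero β α n + α = 1) : orbitZero β α (n + 1) = 0 := by
  have h1 := (isCoding_kneadZero h).step n
  have h2 := orbitZero_lt_one β α (n + 1)
  rcases fin_two_cases (kneadZero β α n) with e | e <;> rw [e] at h1 <;> simp at h1 <;> linarith

/-- Being the concatenation of copies of a finite word. -/
def IsPeriodic (ω : ℕ → Fin 2) : Prop := ∃ L, 0 < L ∧ Function.Periodic ω L

theorem isPeriodic_flip {ω : ℕ → Fin 2} : IsPeriodic (flip ω) ↔ IsPeriodic ω :=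
  exists_congr fun _ => and_congr Iff.rfl periodic_flip

theorem critical_ne_of_not_isPeriodic (h : (β, α) ∈ paramSet)
    (hp : ¬ IsPeriodic (kneadZero β α)) (n : ℕ) : β * orbitZero β α n + α ≠ 1 := fun hn =>
  hp ⟨n + 1, by omega, periodic_of_orbitZero_eq_zero h (orbitZero_succ_eq_zero h hn)⟩

theorem kneadZero_eq_zero_iff (h : (β, α) ∈ paramSet) (n : ℕ) :
    kneadZero β α n = 0 ↔ β * orbitZero β α n + α < 1 :=
  upperExpansion_eq_zero_iff (one_lt_of_mem h) 0 n

theorem IsPath.perturb_orbitZero (hA : IsPath β A r) (h : (β, α) ∈ paramSet) {t : ℝ}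
    (ht : t ∈ Set.Icc 0 r) {n : ℕ}
    (hn : ∀ i < n, kneadZero β α i = kneadZero (β - t) (α + A t * t) i) :
    (β - t) * orbitZero (β - t) (α + A t * t) n + (α + A t * t) - (β * orbitZero β α n + α) =
      (β - t) ^ n * (t * ∑ i ∈ Finset.range (n + 1),
        (β - t)⁻¹ ^ i * (A t - orbitZero β α i)) := by
  have h' := hA.mem_paramSet h ht
  have hβ' := one_lt_of_mem h'
  rw [(isCoding_kneadZero h).perturb (by linarith) (isCoding_kneadZero h') rfl hn]
  congr 1
  rw [Finset.mul_sum]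
  refine Finset.sum_congr rfl fun i _ => ?_
  ring

/-- If `τ⁺(0)` is not periodic, it increases along every path whose direction exceeds the weighted
mean of the orbit of `0`: no early letter changes, and the orbit has moved to the right by the time
of the first change. -/
theorem IsPath.eventually_kneadZero_lt (hA : IsPath β A r) (h : (β, α) ∈ paramSet)
    (hp : ¬ IsPeriodic (kneadZero β α)) (hpos : 0 < ∑' i, β⁻¹ ^ i * (A 0 - orbitZero β α i)) :
    ∀ᶠ t in 𝓝[>] (0 : ℝ), toLex (kneadZero β α) < toLex (kneadZero (β - t) (α + A t * t)) := by
  obtain ⟨N, c, hc, hN⟩ := hA.eventually_le_sum (one_lt_of_mem h) (isCoding_kneadZero h).mem hpos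
  have hag := (hA.tendsto h).eventually (eventually_upperExpansion_eq h (x := 0) ⟨le_rfl, one_pos⟩
    (k := N) fun i _ => critical_ne_of_not_isPeriodic h hp i)
  filter_upwards [hN, hag, hA.eventually_mem] with t ht hagt htr
  have ht' : t ∈ Set.Icc 0 r := ⟨htr.1.le, htr.2⟩
  have h' := hA.mem_paramSet h ht'
  have hβ' := one_lt_of_mem h'
  have hmove : ∀ n ≥ N, (∀ i < n, kneadZero β α i = kneadZero (β - t) (α + A t * t) i) →
      (β - t) ^ n * (t * c) ≤ (β - t) * orbitZero (β - t) (α + A t * t) n + (α + A t * t) -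
        (β * orbitZero β α n + α) := by
    intro n hn hagn
    rw [hA.perturb_orbitZero h ht' hagn]
    have h1 := ht (n + 1) (by omega)
    have h2 := htr.1
    gcongr
  have hne : kneadZero β α ≠ kneadZero (β - t) (α + A t * t) := by
    intro heq
    obtain ⟨n, hn⟩ := pow_unbounded_of_one_lt (2 / (t * c)) hβ'
    have htc : 0 < t * c := mul_pos htr.1 hc
    rw [div_lt_iff₀ htc] at hn
    have h1 := hmove (max n N) (le_max_right _ _) fun i _ => congrFun heq i
    have h2 : (β - t) ^ n * (t * c) ≤ (β - t) ^ (max n N) * (t * c) :=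
      mul_le_mul_of_nonneg_right (pow_le_pow_right₀ hβ'.le (le_max_left _ _)) htc.le
    have h3 := (isCoding_kneadZero h').step (max n N)
    have h4 := (isCoding_kneadZero h).step (max n N)
    rw [← heq] at h3
    linarith [((isCoding_kneadZero h').mem (max n N + 1)).2,
      ((isCoding_kneadZero h).mem (max n N + 1)).1]
  obtain ⟨n, hn, hd⟩ := exists_first_ne hne
  have hnN : N ≤ n := by
    by_contra hlt
    exact hd (hagt n (by omega)).symm
  refine toLex_lt_iff.2 ⟨n, hn, ?_⟩
  have h1 := hmove n hnN hn
  have h2 : 0 < (β - t) ^ n * (t * c) := mul_pos (by positivity) (mul_pos htr.1 hc)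
  have h3 := kneadZero_eq_zero_iff h n
  have h4 := kneadZero_eq_zero_iff h' n
  rcases fin_two_cases (kneadZero β α n) with e | e
  · exact ⟨e, by omega⟩
  · have e' : kneadZero (β - t) (α + A t * t) n = 0 := by omega
    have := h3.2 (by linarith [h4.1 e'])
    omega

/-- Along such a path `τ⁺(0)` becomes periodic for arbitrarily small `t`: at the earliest letter
that changes, the orbit of `0` crosses the critical point. -/
theorem IsPath.frequently_isPeriodic (hA : IsPath β A r) (h : (β, α) ∈ paramSet)
    (hlt : ∀ᶠ t in 𝓝[>] (0 : ℝ),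
      toLex (kneadZero β α) < toLex (kneadZero (β - t) (α + A t * t))) :
    ∃ᶠ t in 𝓝[>] (0 : ℝ), IsPeriodic (kneadZero (β - t) (α + A t * t)) := by
  classical
  intro hev
  obtain ⟨ε, hε0, hε⟩ := mem_nhdsGT_iff_exists_Ioc_subset.1
    ((hlt.and hev).and hA.eventually_mem)
  have hε0 : 0 < ε := hε0
  have hex : ∃ n, ∃ t ∈ Set.Ioc 0 ε, kneadZero β α n = 0 ∧
      kneadZero (β - t) (α + A t * t) n = 1 := by
    obtain ⟨n, -, hn⟩ := toLex_lt_iff.1 (hε ⟨hε0, le_rfl⟩).1.1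
    exact ⟨n, ε, ⟨hε0, le_rfl⟩, hn⟩
  set n := Nat.find hex with hn
  obtain ⟨u, hu, hu0, hu1⟩ := Nat.find_spec hex
  rw [← hn] at hu0 hu1
  have hur : u ≤ r := (hε hu).2.2
  have hag : ∀ t ∈ Set.Icc 0 u, ∀ i < n, kneadZero β α i = kneadZero (β - t) (α + A t * t) i := by
    intro t ht i hi
    rcases ht.1.eq_or_lt with rfl | ht0
    · simp
    · have htε : t ∈ Set.Ioc 0 ε := ⟨ht0, ht.2.trans hu.2⟩
      obtain ⟨m, hm, hm0⟩ := toLex_lt_iff.1 (hε htε).1.1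
      exact hm i (hi.trans_le (Nat.find_min' hex ⟨t, htε, hm0⟩))
  -- The orbit of `0` with the letters of the unperturbed word is continuous in `t`.
  have hcont : ∀ k ≤ n, ContinuousOn (fun t => orbitZero (β - t) (α + A t * t) k)
      (Set.Icc 0 u) := by
    have hAc : ContinuousOn A (Set.Icc 0 u) := hA.cont.mono (Set.Icc_subset_Icc_right hur)
    intro k
    induction k with
    | zero => exact fun _ => continuousOn_const
    | succ k ih =>
      intro hk
      have hc : ContinuousOn (fun t => (β - t) * orbitZero (β - t) (α + A t * t) k +
          (α + A t * t) - ((kneadZero β α k : ℕ) : ℝ)) (Set.Icc 0 u) :=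
        (((continuousOn_const.sub continuousOn_id).mul (ih (by omega))).add
          (continuousOn_const.add (hAc.mul continuousOn_id))).sub continuousOn_const
      refine hc.congr fun t ht => ?_
      have h' := hA.mem_paramSet h ⟨ht.1, ht.2.trans hur⟩
      rw [(isCoding_kneadZero h').step, hag t ht k (by omega)]
  have hg : ContinuousOn (fun t => (β - t) * orbitZero (β - t) (α + A t * t) n + (α + A t * t))
      (Set.Icc 0 u) :=
    ((continuousOn_const.sub continuousOn_id).mul (hcont n le_rfl)).add
      (continuousOn_const.add ((hA.cont.mono (Set.Icc_subset_Icc_right hur)).mul continuousOn_id))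
  have hg0 : β * orbitZero β α n + α < 1 := (kneadZero_eq_zero_iff h n).1 hu0
  have hg1 : 1 ≤ (β - u) * orbitZero (β - u) (α + A u * u) n + (α + A u * u) := by
    by_contra hc
    have h' := hA.mem_paramSet h ⟨hu.1.le, hur⟩
    rw [(kneadZero_eq_zero_iff h' n).2 (not_le.1 hc)] at hu1
    exact absurd hu1 (by decide)
  obtain ⟨t, ht, ht1⟩ := intermediate_value_Icc hu.1.le hg ⟨by simpa using hg0.le, hg1⟩
  simp only at ht1
  have ht0 : 0 < t := by
    rcases ht.1.eq_or_lt with rfl | ht0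
    · simp at ht1
      linarith
    · exact ht0
  have h' := hA.mem_paramSet h ⟨ht.1, ht.2.trans hur⟩
  exact (hε ⟨ht0, ht.2.trans hu.2⟩).1.2
    ⟨n + 1, by omega, periodic_of_orbitZero_eq_zero h' (orbitZero_succ_eq_zero h' ht1)⟩

theorem IsPath.reflect_param (A : ℝ → ℝ) (β α t : ℝ) :
    2 - β - α + (1 - A t) * t = 2 - (β - t) - (α + A t * t) := by ring

theorem IsPath.eventually_kneadOne_lt (hA : IsPath β A r) (h : (β, α) ∈ paramSet)
    (hp : ¬ IsPeriodic (kneadOne β α)) (hpos : 0 < ∑' i, β⁻¹ ^ i * (orbitOne β α i - A 0)) :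
    ∀ᶠ t in 𝓝[>] (0 : ℝ), toLex (kneadOne (β - t) (α + A t * t)) < toLex (kneadOne β α) := by
  have hr := kneadZero_reflect h
  have := hA.reflect.eventually_kneadZero_lt (reflect_mem h)
    (by rwa [hr.1, isPeriodic_flip]) (by
      refine hpos.trans_eq (tsum_congr fun i => ?_)
      rw [hr.2]
      ring)
  filter_upwards [this, hA.eventually_mem] with t ht htr
  have h' := hA.mem_paramSet h ⟨htr.1.le, htr.2⟩
  rw [IsPath.reflect_param, hr.1, (kneadZero_reflect h').1] at ht
  exact toLex_flip_lt.1 ht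

theorem IsPath.frequently_isPeriodic_kneadOne (hA : IsPath β A r) (h : (β, α) ∈ paramSet)
    (hlt : ∀ᶠ t in 𝓝[>] (0 : ℝ),
      toLex (kneadOne (β - t) (α + A t * t)) < toLex (kneadOne β α)) :
    ∃ᶠ t in 𝓝[>] (0 : ℝ), IsPeriodic (kneadOne (β - t) (α + A t * t)) := by
  have hr := kneadZero_reflect h
  have := hA.reflect.frequently_isPeriodic (reflect_mem h) (by
    filter_upwards [hlt, hA.eventually_mem] with t ht htr
    have h' := hA.mem_paramSet h ⟨htr.1.le, htr.2⟩
    rw [IsPath.reflect_param, hr.1, (kneadZero_reflect h').1]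
    exact toLex_flip_lt.2 ht)
  refine (this.and_eventually hA.eventually_mem).mono fun t ht => ?_
  have h' := hA.mem_paramSet h ⟨ht.2.1.le, ht.2.2⟩
  have ht1 := ht.1
  rwa [IsPath.reflect_param, (kneadZero_reflect h').1, isPeriodic_flip] at ht1

end Path

/-! ### Approximation from inside -/

section Approximation

variable {β α : ℝ}

theorem summable_orbit {x : ℕ → ℝ} (hβ : 1 < β) (hx : ∀ i, x i ∈ Set.Icc (0 : ℝ) 1) :
    Summable fun i => β⁻¹ ^ i * x i := by
  have : 0 < β := by linarith
  exact summable_geom_mul (C := 1) (by positivity) (inv_lt_one_of_one_lt₀ hβ)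
    fun i => by rw [abs_of_nonneg (hx i).1]; exact (hx i).2

/-- `Inner β α q` says that both kneading sequences for `q` lie between those for `(β, α)`, which
is to say that the shift for `q` is contained in the one for `(β, α)`. -/
def Inner (β α : ℝ) (q : ℝ × ℝ) : Prop :=
  q ∈ paramSet ∧ toLex (kneadZero β α) ≤ toLex (kneadZero q.1 q.2) ∧
    toLex (kneadOne q.1 q.2) ≤ toLex (kneadOne β α)

theorem Inner.trans {q q' : ℝ × ℝ} (h : Inner β α q) (h' : Inner q.1 q.2 q') : Inner β α q' :=
  ⟨h'.1, h.2.1.trans h'.2.1, h'.2.2.trans h.2.2⟩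

theorem inner_reflect (h : (β, α) ∈ paramSet) {q : ℝ × ℝ}
    (hq : Inner β (2 - β - α) q) : Inner β α (q.1, 2 - q.1 - q.2) := by
  have h1 := toLex_le_flip hq.2.1
  have h2 := toLex_le_flip hq.2.2
  rw [(kneadZero_reflect h).1, flip_flip, ← kneadOne_reflect hq.1] at h1
  rw [kneadOne_reflect h, flip_flip, ← (kneadZero_reflect hq.1).1] at h2
  exact ⟨reflect_mem hq.1, h2, h1⟩

/-- The direction is a constant strictly between the weighted means of the orbits of `0` and of
`1`, so that `τ⁺(0)` increases while `τ⁻(1)` decreases. -/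
theorem frequently_isPeriodic_kneadZero (h : (β, α) ∈ paramSet)
    (h0 : ¬ IsPeriodic (kneadZero β α)) (h1 : ¬ IsPeriodic (kneadOne β α)) :
    ∃ᶠ q in 𝓝[paramSet] (β, α), Inner β α q ∧ IsPeriodic (kneadZero q.1 q.2) := by
  have hβ := one_lt_of_mem h
  have hβ0 : 0 < β := by linarith
  have hβ1 : β⁻¹ < 1 := inv_lt_one_of_one_lt₀ hβ
  have hx := (isCoding_kneadZero h).mem
  have hy := (isCoding_kneadOne h).mem
  have hsx := summable_orbit hβ hx
  have hsy := summable_orbit hβ hy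
  have hsg : Summable fun i : ℕ => β⁻¹ ^ i := summable_geometric_of_lt_one (by positivity) hβ1
  have hgap := tsum_orbitOne_sub_orbitZero_pos h
  simp only [mul_sub] at hgap
  rw [hsy.tsum_sub hsx] at hgap
  have hX0 : 0 ≤ ∑' i, β⁻¹ ^ i * orbitZero β α i :=
    tsum_nonneg fun i => mul_nonneg (by positivity) (hx i).1
  have hYg : ∑' i, β⁻¹ ^ i * orbitOne β α i ≤ ∑' i, β⁻¹ ^ i :=
    hsy.tsum_le_tsum (fun i => mul_le_of_le_one_right (by positivity) (hy i).2) hsg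
  set X := ∑' i, β⁻¹ ^ i * orbitZero β α i
  set Y := ∑' i, β⁻¹ ^ i * orbitOne β α i
  set g := ∑' i, β⁻¹ ^ i
  have hg : 0 < g := by linarith
  set a := (X + Y) / (2 * g) with ha
  have hag : g * a = (X + Y) / 2 := by rw [ha]; field_simp
  have hA : IsPath β (fun _ => a) ((β - 1) / 2) := by
    refine ⟨by linarith, by linarith, continuousOn_const, fun _ _ => ⟨?_, ?_⟩⟩
    · exact div_nonneg (by linarith) (by linarith)
    · rw [ha, div_le_one (by linarith)]
      linarith
  have hup := hA.eventually_kneadZero_lt h h0 (by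
    simp only [mul_sub]
    rw [(hsg.mul_right a).tsum_sub hsx, tsum_mul_right]
    linarith)
  have hdown := hA.eventually_kneadOne_lt h h1 (by
    simp only [mul_sub]
    rw [hsy.tsum_sub (hsg.mul_right a), tsum_mul_right]
    linarith)
  refine (hA.tendsto h).frequently (((hA.frequently_isPeriodic h hup).and_eventually
    (hup.and (hdown.and hA.eventually_mem))).mono fun t ht => ⟨⟨?_, ?_, ?_⟩, ht.1⟩)
  · exact hA.mem_paramSet h ⟨ht.2.2.2.1.le, ht.2.2.2.2⟩
  · exact ht.2.1.le
  · exact ht.2.2.1.le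

/-- If `τ⁺(0)` is periodic, it is constant along the path whose direction is the weighted mean of
the orbit of `0`, while `τ⁻(1)` decreases. -/
theorem frequently_of_isPeriodic_kneadZero (h : (β, α) ∈ paramSet)
    (h0 : IsPeriodic (kneadZero β α)) (h1 : ¬ IsPeriodic (kneadOne β α)) :
    ∃ᶠ q in 𝓝[paramSet] (β, α), Inner β α q ∧
      IsPeriodic (kneadZero q.1 q.2) ∧ IsPeriodic (kneadOne q.1 q.2) := by
  classical
  have hβ := one_lt_of_mem h
  have hβ0 : 0 < β := by linarith
  have hβ1 : β⁻¹ < 1 := inv_lt_one_of_one_lt₀ hβ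
  have hx := (isCoding_kneadZero h).mem
  have hy := (isCoding_kneadOne h).mem
  have hex : ∃ L, 0 < L ∧ orbitZero β α L = 0 := by
    obtain ⟨L, hL, hper⟩ := h0
    refine ⟨L, hL, ?_⟩
    have := orbitZero_periodic h hper 0
    rwa [zero_add, orbitZero_zero] at this
  obtain ⟨L, ⟨hL0, hL⟩, hmin⟩ : ∃ L, (0 < L ∧ orbitZero β α L = 0) ∧
      ∀ m < L, ¬ (0 < m ∧ orbitZero β α m = 0) :=
    ⟨Nat.find hex, Nat.find_spec hex, fun m hm => Nat.find_min hex hm⟩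
  have hper := periodic_of_orbitZero_eq_zero h hL
  obtain ⟨l, rfl⟩ : ∃ l, L = l + 1 := ⟨L - 1, by omega⟩
  let W : ℝ → ℝ := fun t => ∑ i ∈ Finset.range (l + 1), (β - t)⁻¹ ^ i
  let A : ℝ → ℝ := fun t => (∑ i ∈ Finset.range (l + 1), (β - t)⁻¹ ^ i * orbitZero β α i) / W t
  have hr : ∀ t ∈ Set.Icc 0 ((β - 1) / 2), 0 < β - t := fun t ht => by linarith [ht.2]
  have hW : ∀ t ∈ Set.Icc 0 ((β - 1) / 2), 0 < W t := fun t ht =>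
    Finset.sum_pos (fun i _ => pow_pos (inv_pos.2 (hr t ht)) i) ⟨0, by simp⟩
  have hA : IsPath β A ((β - 1) / 2) := by
    refine ⟨by linarith, by linarith, ?_, fun t ht => ⟨?_, ?_⟩⟩
    · have hinv : ContinuousOn (fun t : ℝ => (β - t)⁻¹) (Set.Icc 0 ((β - 1) / 2)) :=
        (continuousOn_const.sub continuousOn_id).inv₀ fun t ht => (hr t ht).ne'
      exact (continuousOn_finsetSum _ fun i _ => (hinv.pow i).mul continuousOn_const).div
        (continuousOn_finsetSum _ fun i _ => hinv.pow i) fun t ht => (hW t ht).ne'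
    · exact div_nonneg (Finset.sum_nonneg fun i _ =>
        mul_nonneg (pow_nonneg (inv_nonneg.2 (hr t ht).le) i) (hx i).1) (hW t ht).le
    · refine (div_le_one (hW t ht)).2 (Finset.sum_le_sum fun i _ => ?_)
      exact mul_le_of_le_one_right (pow_nonneg (inv_nonneg.2 (hr t ht).le) i) (hx i).2
  have hmean : ∀ t ∈ Set.Icc 0 ((β - 1) / 2),
      ∑ i ∈ Finset.range (l + 1), (β - t)⁻¹ ^ i * (A t - orbitZero β α i) = 0 := by
    intro t ht
    simp only [mul_sub]
    rw [Finset.sum_sub_distrib, ← Finset.sum_mul, sub_eq_zero]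
    exact mul_div_cancel₀ _ (hW t ht).ne'
  have hconst : ∀ᶠ t in 𝓝[>] (0 : ℝ), kneadZero (β - t) (α + A t * t) = kneadZero β α := by
    have hag := (hA.tendsto h).eventually (eventually_upperExpansion_eq h (x := 0)
      ⟨le_rfl, one_pos⟩ (k := l) fun i hi hc =>
        hmin (i + 1) (by omega) ⟨by omega, orbitZero_succ_eq_zero h hc⟩)
    filter_upwards [hag, hA.eventually_mem] with t hagt htr
    have ht : t ∈ Set.Icc 0 ((β - 1) / 2) := ⟨htr.1.le, htr.2⟩
    have h' := hA.mem_paramSet h ht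
    have hl := hA.perturb_orbitZero h ht (n := l) fun i hi => (hagt i hi).symm
    rw [hmean t ht, mul_zero, mul_zero, sub_eq_zero] at hl
    have hdl : kneadZero (β - t) (α + A t * t) l = kneadZero β α l := by
      have e1 := kneadZero_eq_zero_iff h l
      have e2 := kneadZero_eq_zero_iff h' l
      rw [hl] at e2
      have := e2.trans e1.symm
      omega
    have hL' : orbitZero (β - t) (α + A t * t) (l + 1) = 0 := by
      rw [(isCoding_kneadZero h').step, hl, hdl, ← (isCoding_kneadZero h).step, hL]
    have hper' := periodic_of_orbitZero_eq_zero h' hL'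
    funext i
    rw [← hper.map_mod_nat, ← hper'.map_mod_nat]
    rcases Nat.lt_succ_iff_lt_or_eq.1 (Nat.mod_lt i hL0) with hi | hi
    · exact hagt _ hi
    · rw [hi, hdl]
  have hx0 : ∑' i, β⁻¹ ^ i * (A 0 - orbitZero β α i) = 0 := by
    have h00 : (0 : ℝ) ∈ Set.Icc 0 ((β - 1) / 2) := ⟨le_rfl, by linarith⟩
    have hb : ∀ i, |A 0 - orbitZero β α i| ≤ 1 := fun i =>
      abs_le.2 ⟨by linarith [(hA.mem 0 h00).1, (hx i).2], by linarith [(hA.mem 0 h00).2, (hx i).1]⟩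
    have e1 := (summable_geom_mul (inv_pos.2 hβ0).le hβ1 hb).sum_add_tsum_nat_add (l + 1)
    have e2 := hmean 0 h00
    have e3 : ∑' i, β⁻¹ ^ (i + (l + 1)) * (A 0 - orbitZero β α (i + (l + 1))) =
        β⁻¹ ^ (l + 1) * ∑' i, β⁻¹ ^ i * (A 0 - orbitZero β α i) := by
      rw [← tsum_mul_left]
      refine tsum_congr fun i => ?_
      rw [orbitZero_periodic h hper i, pow_add]
      ring
    rw [sub_zero] at e2
    rw [e2, e3, zero_add] at e1
    have e4 : β⁻¹ ^ (l + 1) < 1 := pow_lt_one₀ (inv_pos.2 hβ0).le hβ1 (by omega)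
    have e5 : (1 - β⁻¹ ^ (l + 1)) * ∑' i, β⁻¹ ^ i * (A 0 - orbitZero β α i) = 0 := by
      linear_combination -e1
    rcases mul_eq_zero.1 e5 with e6 | e6
    · linarith
    · exact e6
  have hdown := hA.eventually_kneadOne_lt h h1 (by
    have hgap := tsum_orbitOne_sub_orbitZero_pos h
    have hsx := summable_orbit hβ hx
    have hsy := summable_orbit hβ hy
    have hsg : Summable fun i : ℕ => β⁻¹ ^ i * A 0 :=
      (summable_geometric_of_lt_one (by positivity) hβ1).mul_right _
    simp only [mul_sub] at hgap hx0 ⊢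
    rw [hsy.tsum_sub hsx] at hgap
    rw [hsg.tsum_sub hsx] at hx0
    rw [hsy.tsum_sub hsg]
    linarith)
  refine (hA.tendsto h).frequently (((hA.frequently_isPeriodic_kneadOne h hdown).and_eventually
    (hconst.and (hdown.and hA.eventually_mem))).mono fun t ht => ⟨⟨?_, ?_, ?_⟩, ?_, ht.1⟩)
  · exact hA.mem_paramSet h ⟨ht.2.2.2.1.le, ht.2.2.2.2⟩
  · exact (congrArg toLex ht.2.1).ge
  · exact ht.2.2.1.le
  · simp only [ht.2.1]
    exact ⟨l + 1, hL0, hper⟩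

theorem tendsto_reflect (β α : ℝ) :
    Tendsto (fun q : ℝ × ℝ => (q.1, 2 - q.1 - q.2)) (𝓝[paramSet] (β, 2 - β - α))
      (𝓝[paramSet] (β, α)) := by
  refine tendsto_nhdsWithin_iff.2 ⟨?_, ?_⟩
  · have : Continuous fun q : ℝ × ℝ => (q.1, 2 - q.1 - q.2) := by fun_prop
    have h1 := this.tendsto (β, 2 - β - α)
    simp only [sub_sub_cancel] at h1
    exact h1.mono_left nhdsWithin_le_nhds
  · filter_upwards [self_mem_nhdsWithin] with q hq
    exact reflect_mem hq

theorem frequently_of_isPeriodic_kneadOne (h : (β, α) ∈ paramSet)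
    (h0 : ¬ IsPeriodic (kneadZero β α)) (h1 : IsPeriodic (kneadOne β α)) :
    ∃ᶠ q in 𝓝[paramSet] (β, α), Inner β α q ∧
      IsPeriodic (kneadZero q.1 q.2) ∧ IsPeriodic (kneadOne q.1 q.2) := by
  have := frequently_of_isPeriodic_kneadZero (reflect_mem h)
    (by rwa [(kneadZero_reflect h).1, isPeriodic_flip])
    (by rwa [kneadOne_reflect h, isPeriodic_flip])
  refine (tendsto_reflect β α).frequently (this.mono fun q ⟨hq, hq0, hq1⟩ =>
    ⟨inner_reflect h hq, ?_, ?_⟩)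
  · rw [(kneadZero_reflect hq.1).1, isPeriodic_flip]
    exact hq1
  · rw [kneadOne_reflect hq.1, isPeriodic_flip]
    exact hq0

/-- Arbitrarily close to `(β, α)` there are parameters with a smaller shift and periodic kneading
sequences. -/
theorem frequently_inner_isPeriodic (h : (β, α) ∈ paramSet) :
    ∃ᶠ q in 𝓝[paramSet] (β, α), Inner β α q ∧
      IsPeriodic (kneadZero q.1 q.2) ∧ IsPeriodic (kneadOne q.1 q.2) := by
  have hboth : ∀ {β α : ℝ}, (β, α) ∈ paramSet → IsPeriodic (kneadZero β α) →
      ∃ᶠ q in 𝓝[paramSet] (β, α), Inner β α q ∧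
        IsPeriodic (kneadZero q.1 q.2) ∧ IsPeriodic (kneadOne q.1 q.2) := by
    intro β α h h0
    by_cases h1 : IsPeriodic (kneadOne β α)
    · exact fun hev => hev.self_of_nhdsWithin h ⟨⟨h, le_rfl, le_rfl⟩, h0, h1⟩
    · exact frequently_of_isPeriodic_kneadZero h h0 h1
  by_cases h0 : IsPeriodic (kneadZero β α)
  · exact hboth h h0
  by_cases h1 : IsPeriodic (kneadOne β α)
  · exact frequently_of_isPeriodic_kneadOne h h0 h1
  intro hev
  refine frequently_isPeriodic_kneadZero h h0 h1 ?_
  filter_upwards [eventually_eventually_nhdsWithin.2 hev] with q hq ⟨hin, hper⟩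
  exact hboth hin.1 hper (hq.mono fun q' hq' ⟨hin', hper'⟩ => hq' ⟨hin.trans hin', hper'⟩)

end Approximation

end IntermediateBeta

theorem corollary1p2 (β α : ℝ) (h : (β, α) ∈ IntermediateBeta.paramSet) :
    ∃ s : ℕ → ℝ × ℝ,
      (∀ n, s n ∈ IntermediateBeta.paramSet) ∧
      Filter.Tendsto s Filter.atTop (nhds (β, α)) ∧
      (∀ n, IntermediateBeta.IsSubshiftOfFiniteType
        (IntermediateBeta.betaShift (s n).1 (s n).2)) ∧
      Filter.Tendsto
        (fun n => IntermediateBeta.wordHausdorffDist (IntermediateBeta.betaShift β α)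
          (IntermediateBeta.betaShift (s n).1 (s n).2))
        Filter.atTop (nhds 0) ∧
      (∀ n, IntermediateBeta.betaShift (s n).1 (s n).2 ⊆ IntermediateBeta.betaShift β α) := by
  obtain ⟨s, hs, hgood⟩ :=
    Filter.exists_seq_forall_of_frequently (IntermediateBeta.frequently_inner_isPeriodic h)
  have hsub : ∀ n, IntermediateBeta.betaShift (s n).1 (s n).2 ⊆ IntermediateBeta.betaShift β α :=
    fun n => IntermediateBeta.betaShift_subset h (hgood n).1.1 (hgood n).1.2.1 (hgood n).1.2.2
  refine ⟨s, fun n => (hgood n).1.1, hs.mono_right nhdsWithin_le_nhds, fun n => ?_,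
    IntermediateBeta.tendsto_wordHausdorffDist h hs hsub, hsub⟩
  obtain ⟨hin, ⟨L, hL, hL0⟩, L', hL', hL1⟩ := hgood n
  exact IntermediateBeta.isSubshiftOfFiniteType_of_periodic hin.1 hL hL' hL0 hL1
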